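/- Let $n \geq 3$ be an integer and let $\sigma \in (1,n-1)$ be a real number. There is a constant $C = C(n,\sigma) > 0$, depending only on $n$ and $\sigma$, with the following property. Let $S^{n-1}$ be the unit sphere and $B^n = \{x \in \mathbb{R}^n : |x| \leq 1\}$ the closed unit ball in $\mathbb{R}^n$, and let $B_r(p)$ denote the open Euclidean ball of radius $r$ centered at $p$. Let $V : S^{n-1} \to \mathbb{R}$ be a nonnegative continuous function such that \[\left( r^{\sigma+1-n} \int_{S^{n-1} \cap B_r(p)} V^\sigma \right)^{\frac{1}{\sigma}} \leq 1\] for all points $p \in \mathbb{R}^n$ and all $0 < r \leq 1$. Let $F$ be a real-valued function which is smooth on $B^n$ (up to the boundary), and let $f$ denote the restriction of $F$ to $\partial B^n = S^{n-1}$. Then \[\int_{S^{n-1}} V f^2 \leq C \int_{B^n} |\nabla F|^2 + C \int_{S^{n-1}} f^2.\] Here the integrals over subsets of $S^{n-1}$ are taken with respect to the standard surface measure and the integral over $B^n$ with respect to Lebesgue measure. -/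

import Mathlib

open MeasureTheory Metric
open scoped ContDiff

/-!
The proof reduces the trace inequality to the boundedness of a Riesz kernel on `L²(V)`, and obtains
the latter from Schur's test with a Neumann series as test function.

Write `n` for the dimension, `d = n - 1`, `S` for the unit sphere and `G` for the norm of the gradient
of `F`, extended by zero from the ball. Averaging the fundamental theorem of calculus over the segments
from `y ∈ S` to the points of the ball bounds `|F y|` by the mean of `|F|` over the ball plus the
potential `∫ |x - y|^(1 - n) G x dx` (`enorm_mul_measure_closedBall_le`). The mean is controlled by
integration along radii (`lintegral_enorm_closedBall_le`), so it remains to bound the potential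
operator from `L²` of the space to `L²(V)` on `S`. By duality, and since the composition of the kernel
with its transpose is at most a multiple of `|y - z|^(2 - n)`
(`lintegral_rieszKernel_mul_rieszKernel_le`), this amounts to bounding the form of the kernel
`|y - z|^(1 - d)` on `L²(V)`, where `S` has dimension `d`.

Let `T h = ∫ |y - z|^(1 - d) V z h z dz`. The Morrey condition on `V` and Hölder's inequality put `V h`
into an `L¹` Morrey space when `h` lies in an `L^q` Morrey space with `q` conjugate to `σ`, and an
elementary form of Adams' theorem, `lintegral_rieszPotential_rpow_le`, sends it back to the space of `h`.
The hypothesis `1 < σ` makes `q` finite and leaves room for the small exponent `ε` which breaks the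
scale invariance. Thus `T` is bounded on this Morrey space, uniformly in `V`, and for large `Λ` the
series `s = ∑ Λ^(-k) T^k 1` is finite almost everywhere for the measure `V`. It satisfies `T s ≤ Λ s`,
so Schur's test gives the bound `Λ` on `L²(V)` (`exists_lintegral_lintegral_rieszKernel_le`).

All intermediate inequalities are between lower integrals with values in `ℝ≥0∞`, where no
integrability has to be checked.
-/

open Set
open scoped NNReal ENNReal

/-! ### Integrals of powers -/

theorem lintegral_Ioi_ofReal_rpow {a r : ℝ} (ha : a < -1) (hr : 0 < r) :
    ∫⁻ t in Ioi r, ENNReal.ofReal t ^ a =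
      ENNReal.ofReal (-(a + 1))⁻¹ * ENNReal.ofReal r ^ (a + 1) := by
  have h1 : ∫⁻ t in Ioi r, ENNReal.ofReal t ^ a = ∫⁻ t in Ioi r, ENNReal.ofReal (t ^ a) :=
    setLIntegral_congr_fun measurableSet_Ioi fun t ht =>
      ENNReal.ofReal_rpow_of_pos (hr.trans ht)
  rw [h1, ← ofReal_integral_eq_lintegral_ofReal (integrableOn_Ioi_rpow_of_lt ha hr)
    ((ae_restrict_mem measurableSet_Ioi).mono fun t ht => Real.rpow_nonneg (hr.trans ht).le _),
    integral_Ioi_rpow_of_lt ha hr, ENNReal.ofReal_rpow_of_pos hr, ← ENNReal.ofReal_mul]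
  · congr 1
    rw [neg_div, ← div_neg, div_eq_inv_mul]
  · rw [inv_nonneg]; linarith

theorem lintegral_Ioc_ofReal_rpow {a r : ℝ} (ha : -1 < a) (hr : 0 < r) :
    ∫⁻ t in Ioc 0 r, ENNReal.ofReal t ^ a =
      ENNReal.ofReal (a + 1)⁻¹ * ENNReal.ofReal r ^ (a + 1) := by
  have h1 : ∫⁻ t in Ioc 0 r, ENNReal.ofReal t ^ a = ∫⁻ t in Ioc 0 r, ENNReal.ofReal (t ^ a) :=
    setLIntegral_congr_fun measurableSet_Ioc fun t ht =>
      ENNReal.ofReal_rpow_of_pos ht.1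
  rw [h1, ← ofReal_integral_eq_lintegral_ofReal
    ((intervalIntegral.intervalIntegrable_rpow' ha).1)
    ((ae_restrict_mem measurableSet_Ioc).mono fun t ht => Real.rpow_nonneg ht.1.le _),
    ← intervalIntegral.integral_of_le hr.le, integral_rpow (Or.inl ha),
    ENNReal.ofReal_rpow_of_pos hr, ← ENNReal.ofReal_mul]
  · congr 1
    rw [Real.zero_rpow (by linarith), sub_zero, div_eq_inv_mul]
  · rw [inv_nonneg]; linarith

/-! ### Riesz kernels and potentials -/

section Kernel

variable {X : Type*} [PseudoMetricSpace X]

/-- The Riesz kernel of exponent `a`, written as a superposition of indicators of balls: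
`∫_{t > 0} t^(-a) 1[dist x y ≤ t] dt`. For `1 < a` it equals `dist x y ^ (1 - a) / (a - 1)`, so the
exponent is shifted by one from the decay of the kernel. The integral over scales is the convenient
form here, since Tonelli's theorem turns every estimate into one about measures of balls. -/
noncomputable def rieszKernel (a : ℝ) (x y : X) : ℝ≥0∞ :=
  ∫⁻ t in Ioi (0 : ℝ), ENNReal.ofReal t ^ (-a) * (closedBall x t).indicator 1 y

theorem indicator_closedBall_comm (x y : X) (t : ℝ) :
    (closedBall x t).indicator (1 : X → ℝ≥0∞) y = (closedBall y t).indicator 1 x := by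
  simp [indicator, mem_closedBall, dist_comm]

theorem rieszKernel_comm (a : ℝ) (x y : X) : rieszKernel a x y = rieszKernel a y x := by
  simp only [rieszKernel, indicator_closedBall_comm x y]

variable [MeasurableSpace X] [OpensMeasurableSpace X] [SecondCountableTopology X]

@[fun_prop]
theorem measurable_indicator_closedBall {Y : Type*} [MeasurableSpace Y] {f g : Y → X} {t : Y → ℝ}
    (hf : Measurable f) (hg : Measurable g) (ht : Measurable t) :
    Measurable fun p => (closedBall (f p) (t p)).indicator (1 : X → ℝ≥0∞) (g p) := by
  have : MeasurableSet {p | dist (g p) (f p) ≤ t p} := measurableSet_le (Measurable.dist hg hf) ht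
  exact (measurable_one (α := ℝ≥0∞)).indicator this

theorem measurable_rieszKernel (a : ℝ) :
    Measurable fun p : X × X => rieszKernel a p.1 p.2 := by
  unfold rieszKernel
  apply Measurable.lintegral_prod_right
  fun_prop

/-- The integral operator `g ↦ ∫ rieszKernel a x y * g y ∂ν(y)`. -/
noncomputable def rieszPotential (a : ℝ) (ν : Measure X) (g : X → ℝ≥0∞) (x : X) : ℝ≥0∞ :=
  ∫⁻ y, rieszKernel a x y * g y ∂ν

theorem measurable_rieszPotential (a : ℝ) (ν : Measure X) [SFinite ν] {g : X → ℝ≥0∞}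
    (hg : Measurable g) : Measurable (rieszPotential a ν g) := by
  unfold rieszPotential
  exact ((measurable_rieszKernel a).mul (hg.comp measurable_snd)).lintegral_prod_right

theorem rieszPotential_eq_lintegral_closedBall (a : ℝ) (ν : Measure X) [SFinite ν]
    {g : X → ℝ≥0∞} (hg : Measurable g) (x : X) :
    rieszPotential a ν g x =
      ∫⁻ t in Ioi (0 : ℝ), ENNReal.ofReal t ^ (-a) * ∫⁻ y in closedBall x t, g y ∂ν := by
  have h1 (t : ℝ) : ENNReal.ofReal t ^ (-a) * ∫⁻ y in closedBall x t, g y ∂ν =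
      ∫⁻ y, ENNReal.ofReal t ^ (-a) * (closedBall x t).indicator 1 y * g y ∂ν := by
    rw [← lintegral_indicator measurableSet_closedBall, ← lintegral_const_mul _
      (hg.indicator measurableSet_closedBall)]
    congr with y
    by_cases hy : y ∈ closedBall x t <;> simp [hy]
  simp only [h1]
  rw [lintegral_lintegral_swap (by fun_prop)]
  unfold rieszPotential rieszKernel
  congr with y
  rw [lintegral_mul_const _ (by fun_prop)]

end Kernel

/-! ### Potentials on Morrey spaces -/

/-- Jensen's inequality for the power `q` and the weight `u`, without normalizing `u`. -/
theorem lintegral_rpow_mul_rpow_le {p q : ℝ} (hpq : p.HolderConjugate q)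
    {u v : ℝ → ℝ≥0∞} (hu : Measurable u) (hv : Measurable v) (s : Set ℝ) :
    (∫⁻ t in s, u t * v t) ^ q ≤ (∫⁻ t in s, u t) ^ (q - 1) * ∫⁻ t in s, u t * v t ^ q := by
  have hp := hpq.pos
  have hq := hpq.symm.pos
  have h := ENNReal.lintegral_mul_le_Lp_mul_Lq (volume.restrict s) hpq
    (f := fun t => u t ^ (1 / p)) (g := fun t => u t ^ (1 / q) * v t)
    (by fun_prop) (by fun_prop)
  have e1 : ∀ t, u t ^ (1 / p) * (u t ^ (1 / q) * v t) = u t * v t := fun t => by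
    rw [← mul_assoc, ← ENNReal.rpow_add_of_nonneg _ _ (by positivity) (by positivity)]
    simp [hpq.inv_add_inv_eq_one]
  have e2 : ∀ t, (u t ^ (1 / p)) ^ p = u t := fun t => by
    rw [← ENNReal.rpow_mul, one_div_mul_cancel hp.ne', ENNReal.rpow_one]
  have e3 : ∀ t, (u t ^ (1 / q) * v t) ^ q = u t * v t ^ q := fun t => by
    rw [ENNReal.mul_rpow_of_nonneg _ _ hq.le, ← ENNReal.rpow_mul,
      one_div_mul_cancel hq.ne', ENNReal.rpow_one]
  simp only [Pi.mul_apply, e1, e2, e3] at h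
  calc _ ≤ _ := ENNReal.rpow_le_rpow h hq.le
    _ = _ := by
      rw [ENNReal.mul_rpow_of_nonneg _ _ hq.le, ← ENNReal.rpow_mul, ← ENNReal.rpow_mul,
        one_div_mul_cancel hq.ne', ENNReal.rpow_one]
      congr 2
      rw [← hpq.symm.div_conj_eq_sub_one]; ring

section Morrey

variable {X : Type*} [PseudoMetricSpace X] [MeasurableSpace X] [OpensMeasurableSpace X]
  [SecondCountableTopology X]

theorem measurable_lintegral_closedBall (ν : Measure X) [SFinite ν] {g : X → ℝ≥0∞}
    (hg : Measurable g) :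
    Measurable fun p : X × ℝ => ∫⁻ y in closedBall p.1 p.2, g y ∂ν := by
  have h1 (p : X × ℝ) : ∫⁻ y in closedBall p.1 p.2, g y ∂ν =
      ∫⁻ y, (closedBall p.1 p.2).indicator 1 y * g y ∂ν := by
    rw [← lintegral_indicator measurableSet_closedBall]
    congr with y
    by_cases hy : y ∈ closedBall p.1 p.2 <;> simp [hy]
  simp only [h1]
  exact Measurable.lintegral_prod_right (by fun_prop)

theorem lintegral_closedBall_lintegral_closedBall_le (ν : Measure X) [SFinite ν] {g : X → ℝ≥0∞}
    (hg : Measurable g) (x : X) {r t : ℝ} (htr : t ≤ r) {K : ℝ≥0∞}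
    (hK : ∀ y, ν (closedBall y t) ≤ K) :
    ∫⁻ z in closedBall x r, ∫⁻ y in closedBall z t, g y ∂ν ∂ν ≤
      K * ∫⁻ y in closedBall x (2 * r), g y ∂ν := by
  have h1 (z : X) (hz : z ∈ closedBall x r) : ∫⁻ y in closedBall z t, g y ∂ν ≤
      ∫⁻ y, (closedBall y t).indicator 1 z * (closedBall x (2 * r)).indicator g y ∂ν := by
    rw [← lintegral_indicator measurableSet_closedBall]
    refine lintegral_mono fun y => ?_
    rw [indicator_closedBall_comm y z t]
    by_cases hy : y ∈ closedBall z t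
    · have : y ∈ closedBall x (2 * r) := by
        rw [mem_closedBall] at *
        linarith [dist_triangle y z x]
      simp [hy, this]
    · simp [hy]
  have hg' := hg.indicator (measurableSet_closedBall (x := x) (ε := 2 * r))
  calc _ ≤ ∫⁻ z in closedBall x r, ∫⁻ y, (closedBall y t).indicator 1 z *
          (closedBall x (2 * r)).indicator g y ∂ν ∂ν :=
        setLIntegral_mono' measurableSet_closedBall h1
    _ ≤ ∫⁻ z, ∫⁻ y, (closedBall y t).indicator 1 z *
          (closedBall x (2 * r)).indicator g y ∂ν ∂ν := setLIntegral_le_lintegral _ _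
    _ = ∫⁻ y, ∫⁻ z, (closedBall y t).indicator 1 z *
          (closedBall x (2 * r)).indicator g y ∂ν ∂ν := by
        rw [lintegral_lintegral_swap (by fun_prop)]
    _ ≤ ∫⁻ y, K * (closedBall x (2 * r)).indicator g y ∂ν := by
        refine lintegral_mono fun y => ?_
        dsimp only
        rw [lintegral_mul_const _ (by fun_prop), lintegral_indicator_one measurableSet_closedBall]
        gcongr
        exact hK y
    _ = _ := by rw [lintegral_const_mul _ hg', lintegral_indicator measurableSet_closedBall]

/-- Adams' theorem on Morrey spaces, in the form needed here: if `g` has mass at most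
`D r^(d - 1 - ε)` on every ball of radius `r` of a space of dimension at most `d`, then on every such
ball the `q`-th power of its potential has integral at most `(M D)^q r^(d - ε q)`.

The scales `t > r` contribute a pointwise bound `r^(-ε)`. For `t ≤ r`, write `m_t z` for the mass of
the ball of radius `t` about `z`; after Jensen, one factor of `(m_t z) ^ q` is integrated in `z` by
Tonelli and the other `q - 1` factors are estimated by the hypothesis. What remains is
`∫_0^r t^(-2 ε (q - 1)) dt`, which converges by `hεq`; no maximal function is needed. -/
theorem lintegral_rieszPotential_rpow_le {d q ε : ℝ} {C : ℝ≥0}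
    (hε : 0 < ε) (hq : 1 < q) (hεq : 2 * ε * (q - 1) < 1) :
    ∃ M : ℝ≥0, ∀ (ν : Measure X) [SFinite ν],
      (∀ x r, 0 < r → ν (closedBall x r) ≤ C * ENNReal.ofReal r ^ d) →
      ∀ (g : X → ℝ≥0∞), Measurable g → ∀ D : ℝ≥0∞,
      (∀ x r, 0 < r → ∫⁻ y in closedBall x r, g y ∂ν ≤ D * ENNReal.ofReal r ^ (d - 1 - ε)) →
      ∀ x r, 0 < r → ∫⁻ z in closedBall x r, rieszPotential d ν g z ^ q ∂ν ≤
        (M * D) ^ q * ENNReal.ofReal r ^ (d - ε * q) := by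
  set E := ENNReal.ofReal with hE
  let N : ℝ≥0∞ := 2 ^ (q - 1) * (C * E ε⁻¹ ^ (q - 1) * 2 ^ (d - 1 - ε) *
    E (1 - 2 * ε * (q - 1))⁻¹ + E ε⁻¹ ^ q * C)
  have hN : N ^ (1 / q) ≠ ⊤ := by
    have : (2 : ℝ≥0∞) ^ (d - 1 - ε) ≠ ⊤ := ENNReal.rpow_ne_top_of_ne_zero (by simp) (by simp)
    simp only [N]
    finiteness
  refine ⟨(N ^ (1 / q)).toNNReal, fun ν _ hν g hg D hD x r hr => ?_⟩
  rw [ENNReal.coe_toNNReal hN, ENNReal.mul_rpow_of_nonneg _ _ (by linarith), ← ENNReal.rpow_mul,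
    one_div_mul_cancel (by linarith), ENNReal.rpow_one]
  have hE0 : ∀ {t : ℝ}, 0 < t → E t ≠ 0 := fun ht => by simpa [hE] using ht
  have hET : ∀ {t : ℝ}, E t ≠ ⊤ := by simp [hE]
  set m : X → ℝ → ℝ≥0∞ := fun z t => ∫⁻ y in closedBall z t, g y ∂ν with hm
  have hmm : Measurable fun p : X × ℝ => m p.1 p.2 := measurable_lintegral_closedBall ν hg
  -- splitting of the potential at the scale `r`
  have hsplit (z : X) : rieszPotential d ν g z =
      (∫⁻ t in Ioc 0 r, E t ^ (-d) * m z t) + ∫⁻ t in Ioi r, E t ^ (-d) * m z t := by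
    rw [rieszPotential_eq_lintegral_closedBall d ν hg, ← Ioc_union_Ioi_eq_Ioi hr.le,
      lintegral_union measurableSet_Ioi (Ioc_disjoint_Ioi le_rfl)]
  have hfar (z : X) : ∫⁻ t in Ioi r, E t ^ (-d) * m z t ≤ D * (E ε⁻¹ * E r ^ (-ε)) := by
    calc _ ≤ ∫⁻ t in Ioi r, D * E t ^ (-1 - ε) := by
          refine setLIntegral_mono' measurableSet_Ioi fun t ht => ?_
          have ht0 : 0 < t := hr.trans ht
          calc _ ≤ E t ^ (-d) * (D * E t ^ (d - 1 - ε)) := by gcongr; exact hD z t ht0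
            _ = D * (E t ^ (-d) * E t ^ (d - 1 - ε)) := by ring
            _ = _ := by rw [← ENNReal.rpow_add _ _ (hE0 ht0) hET]; congr 2; ring
      _ = _ := by
          rw [lintegral_const_mul _ (by fun_prop), lintegral_Ioi_ofReal_rpow (by linarith) hr]
          congr 4 <;> ring
  have hnear (z : X) : (∫⁻ t in Ioc 0 r, E t ^ (-d) * m z t) ^ q ≤
      (E ε⁻¹ * E r ^ ε) ^ (q - 1) * D ^ (q - 1) *
        ∫⁻ t in Ioc 0 r, E t ^ (-(2 * ε * (q - 1)) - d) * m z t := by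
    -- Jensen with the weight `t ^ (ε - 1)`, which is integrable at `0` and has total mass `r ^ ε / ε`
    have h1 : ∫⁻ t in Ioc 0 r, E t ^ (-d) * m z t =
        ∫⁻ t in Ioc 0 r, E t ^ (ε - 1) * (E t ^ (1 - ε - d) * m z t) := by
      refine setLIntegral_congr_fun measurableSet_Ioc fun t ht => ?_
      rw [← mul_assoc, ← ENNReal.rpow_add _ _ (hE0 ht.1) hET]
      congr 2; ring
    rw [h1]
    have hpq : (q / (q - 1)).HolderConjugate q := (Real.HolderConjugate.conjExponent hq).symm
    refine (lintegral_rpow_mul_rpow_le hpq (by fun_prop) (by fun_prop) _).trans ?_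
    rw [lintegral_Ioc_ofReal_rpow (by linarith) hr, sub_add_cancel, mul_assoc]
    gcongr
    rw [← lintegral_const_mul _ (by fun_prop)]
    refine setLIntegral_mono' measurableSet_Ioc fun t ht => ?_
    have ht0 := ht.1
    calc E t ^ (ε - 1) * (E t ^ (1 - ε - d) * m z t) ^ q
        = E t ^ (ε - 1) * E t ^ ((1 - ε - d) * q) * (m z t ^ (q - 1) * m z t) := by
          rw [ENNReal.mul_rpow_of_nonneg _ _ (by linarith), ← ENNReal.rpow_mul, ← mul_assoc]
          congr 1
          nth_rw 3 [← ENNReal.rpow_one (m z t)]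
          rw [← ENNReal.rpow_add_of_nonneg _ _ (by linarith) (by simp), sub_add_cancel]
      _ ≤ E t ^ (ε - 1) * E t ^ ((1 - ε - d) * q) *
            ((D * E t ^ (d - 1 - ε)) ^ (q - 1) * m z t) := by
          have : 0 ≤ q - 1 := by linarith
          gcongr
          exact hD z t ht0
      _ = D ^ (q - 1) * ((E t ^ (ε - 1) * E t ^ ((1 - ε - d) * q) *
            E t ^ ((d - 1 - ε) * (q - 1))) * m z t) := by
          rw [ENNReal.mul_rpow_of_nonneg _ _ (by linarith), ← ENNReal.rpow_mul]; ring
      _ = _ := by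
          rw [← ENNReal.rpow_add _ _ (hE0 ht0) hET, ← ENNReal.rpow_add _ _ (hE0 ht0) hET]
          congr 3; ring
  have hnear' : ∫⁻ z in closedBall x r, (∫⁻ t in Ioc 0 r, E t ^ (-d) * m z t) ^ q ∂ν ≤
      (E ε⁻¹ * E r ^ ε) ^ (q - 1) * D ^ (q - 1) *
        (C * (D * E (2 * r) ^ (d - 1 - ε)) *
          (E (1 - 2 * ε * (q - 1))⁻¹ * E r ^ (1 - 2 * ε * (q - 1)))) := by
    calc _ ≤ ∫⁻ z in closedBall x r, (E ε⁻¹ * E r ^ ε) ^ (q - 1) * D ^ (q - 1) *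
        (∫⁻ t in Ioc 0 r, E t ^ (-(2 * ε * (q - 1)) - d) * m z t) ∂ν :=
          lintegral_mono fun z => hnear z
      _ = (E ε⁻¹ * E r ^ ε) ^ (q - 1) * D ^ (q - 1) * ∫⁻ t in Ioc 0 r, ∫⁻ z in closedBall x r,
          E t ^ (-(2 * ε * (q - 1)) - d) * m z t ∂ν := by
          rw [lintegral_const_mul, lintegral_lintegral_swap]
          · exact ((by fun_prop : Measurable fun p : X × ℝ =>
              E p.2 ^ (-(2 * ε * (q - 1)) - d)).mul hmm).aemeasurable
          · exact ((by fun_prop : Measurable fun p : X × ℝ =>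
              E p.2 ^ (-(2 * ε * (q - 1)) - d)).mul hmm).lintegral_prod_right'
      _ ≤ (E ε⁻¹ * E r ^ ε) ^ (q - 1) * D ^ (q - 1) * ∫⁻ t in Ioc 0 r,
          C * (D * E (2 * r) ^ (d - 1 - ε)) * E t ^ (-(2 * ε * (q - 1))) := by
          refine mul_le_mul' le_rfl ?_
          refine setLIntegral_mono' measurableSet_Ioc fun t ht => ?_
          have ht0 := ht.1
          have hmt : Measurable fun z => m z t :=
            hmm.comp (by fun_prop : Measurable fun z : X => (z, t))
          rw [lintegral_const_mul _ hmt]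
          calc _ ≤ E t ^ (-(2 * ε * (q - 1)) - d) *
                ((C * E t ^ d) * (D * E (2 * r) ^ (d - 1 - ε))) := by
                gcongr
                refine (lintegral_closedBall_lintegral_closedBall_le ν hg x ht.2
                  (fun y => hν y t ht0)).trans ?_
                gcongr
                exact hD x (2 * r) (by linarith)
            _ = C * (D * E (2 * r) ^ (d - 1 - ε)) *
                (E t ^ (-(2 * ε * (q - 1)) - d) * E t ^ d) := by ring
            _ = _ := by
              rw [← ENNReal.rpow_add _ _ (hE0 ht0) hET]; congr 2; ring
      _ = _ := by
          rw [lintegral_const_mul _ (by fun_prop), lintegral_Ioc_ofReal_rpow (by linarith) hr]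
          rw [neg_add_eq_sub]
  have hmeas1 : Measurable fun z => (∫⁻ t in Ioc 0 r, E t ^ (-d) * m z t) ^ q :=
    (((by fun_prop : Measurable fun p : X × ℝ => E p.2 ^ (-d)).mul
      hmm).lintegral_prod_right').pow_const q
  calc _ ≤ ∫⁻ z in closedBall x r, 2 ^ (q - 1) * ((∫⁻ t in Ioc 0 r, E t ^ (-d) * m z t) ^ q +
        (D * (E ε⁻¹ * E r ^ (-ε))) ^ q) ∂ν := by
        refine lintegral_mono fun z => ?_
        dsimp only
        rw [hsplit z]
        refine (ENNReal.rpow_add_le_mul_rpow_add_rpow _ _ hq.le).trans ?_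
        gcongr
        exact hfar z
    _ = 2 ^ (q - 1) * (∫⁻ z in closedBall x r, (∫⁻ t in Ioc 0 r, E t ^ (-d) * m z t) ^ q ∂ν +
        (D * (E ε⁻¹ * E r ^ (-ε))) ^ q * ν (closedBall x r)) := by
        rw [lintegral_const_mul _ (by fun_prop), lintegral_add_left hmeas1, setLIntegral_const]
    _ ≤ 2 ^ (q - 1) * ((E ε⁻¹ * E r ^ ε) ^ (q - 1) * D ^ (q - 1) *
        (C * (D * E (2 * r) ^ (d - 1 - ε)) *
          (E (1 - 2 * ε * (q - 1))⁻¹ * E r ^ (1 - 2 * ε * (q - 1)))) +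
        (D * (E ε⁻¹ * E r ^ (-ε))) ^ q * (C * E r ^ d)) := by
        gcongr
        exact hν x r hr
    _ = 2 ^ (q - 1) * (C * E ε⁻¹ ^ (q - 1) * 2 ^ (d - 1 - ε) * E (1 - 2 * ε * (q - 1))⁻¹ *
          (D ^ (q - 1) * D) *
          (E r ^ (ε * (q - 1)) * E r ^ (d - 1 - ε) * E r ^ (1 - 2 * ε * (q - 1))) +
        D ^ q * E ε⁻¹ ^ q * C * (E r ^ (-ε * q) * E r ^ d)) := by
        have h2 : E (2 * r) ^ (d - 1 - ε) = 2 ^ (d - 1 - ε) * E r ^ (d - 1 - ε) := by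
          rw [hE, ENNReal.ofReal_mul (by norm_num),
            ENNReal.mul_rpow_of_ne_top (by simp) (by simp)]
          simp
        have hq1 : 0 ≤ q - 1 := by linarith
        have hq0 : 0 ≤ q := by linarith
        rw [h2, ENNReal.mul_rpow_of_nonneg _ _ hq1, ENNReal.mul_rpow_of_nonneg _ _ hq0,
          ENNReal.mul_rpow_of_nonneg _ _ hq0, ← ENNReal.rpow_mul, ← ENNReal.rpow_mul]
        ring
    _ = N * D ^ q * E r ^ (d - ε * q) := by
        have hDq : D ^ (q - 1) * D = D ^ q := by
          nth_rw 2 [← ENNReal.rpow_one D]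
          rw [← ENNReal.rpow_add_of_nonneg _ _ (by linarith) (by simp), sub_add_cancel]
        rw [hDq, ← ENNReal.rpow_add _ _ (hE0 hr) hET, ← ENNReal.rpow_add _ _ (hE0 hr) hET,
          ← ENNReal.rpow_add _ _ (hE0 hr) hET,
          show ε * (q - 1) + (d - 1 - ε) + (1 - 2 * ε * (q - 1)) = d - ε * q by ring,
          show -ε * q + d = d - ε * q by ring]
        ring

/-! ### Schur's test and duality -/

theorem ENNReal.two_mul_mul_le_sq_mul_add_sq_mul_inv (a b : ℝ≥0∞) {c : ℝ≥0∞} (hc : c ≠ 0)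
    (hc' : c ≠ ⊤) : 2 * (a * b) ≤ a ^ 2 * c + b ^ 2 * c⁻¹ := by
  have hci : c⁻¹ ≠ 0 := ENNReal.inv_ne_zero.2 hc'
  rcases eq_or_ne a ⊤ with rfl | ha
  · simp [ENNReal.top_mul hc]
  rcases eq_or_ne b ⊤ with rfl | hb
  · simp [ENNReal.top_mul hci]
  lift a to ℝ≥0 using ha
  lift b to ℝ≥0 using hb
  lift c to ℝ≥0 using hc'
  have hc0 : c ≠ 0 := by simpa using hc
  rw [← ENNReal.coe_inv hc0]
  norm_cast
  have h : (2 : ℝ) * (a * b) ≤ a ^ 2 * c + b ^ 2 * (c : ℝ)⁻¹ := by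
    have : (a : ℝ) ^ 2 * c + b ^ 2 * (c : ℝ)⁻¹ - 2 * (a * b) = (a * c - b) ^ 2 * (c : ℝ)⁻¹ := by
      field_simp
      ring
    have h2 : 0 ≤ (a * c - b : ℝ) ^ 2 * (c : ℝ)⁻¹ := by positivity
    linarith
  exact_mod_cast h

/-- Schur's test: a symmetric kernel with a positive supersolution `s`, finite almost everywhere,
defines a form bounded by `Λ` on `L²`. -/
theorem lintegral_lintegral_mul_le_of_supersolution {X : Type*} [MeasurableSpace X]
    (μ : Measure X) [SFinite μ] {L : X → X → ℝ≥0∞} (hL : Measurable fun p : X × X => L p.1 p.2)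
    (hsymm : ∀ x y, L x y = L y x) {s : X → ℝ≥0∞} (hs : Measurable s) (hs0 : ∀ x, s x ≠ 0)
    (hsT : ∀ᵐ x ∂μ, s x ≠ ⊤) {Λ : ℝ≥0∞} (hsup : ∀ x, ∫⁻ y, L x y * s y ∂μ ≤ Λ * s x)
    {h : X → ℝ≥0∞} (hh : Measurable h) :
    ∫⁻ x, ∫⁻ y, L x y * (h x * h y) ∂μ ∂μ ≤ Λ * ∫⁻ x, h x ^ 2 ∂μ := by
  have hL' : Measurable (Function.uncurry L) := hL
  have key : ∀ᵐ x ∂μ, ∀ᵐ y ∂μ, 2 * (L x y * (h x * h y)) ≤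
      L x y * (h x ^ 2 * (s y / s x)) + L x y * (h y ^ 2 * (s x / s y)) := by
    filter_upwards [hsT] with x hx
    filter_upwards [hsT] with y hy
    rw [← mul_add, mul_left_comm]
    gcongr
    have := ENNReal.two_mul_mul_le_sq_mul_add_sq_mul_inv (h x) (h y) (c := s y / s x)
      (ENNReal.div_ne_zero.2 ⟨hs0 y, hx⟩) (ENNReal.div_ne_top hy (hs0 x))
    rwa [ENNReal.inv_div (Or.inl hx) (Or.inl (hs0 x))] at this
  have h1 : ∫⁻ x, ∫⁻ y, L x y * (h x ^ 2 * (s y / s x)) ∂μ ∂μ ≤ Λ * ∫⁻ x, h x ^ 2 ∂μ := by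
    rw [← lintegral_const_mul _ (by fun_prop)]
    refine lintegral_mono_ae ?_
    filter_upwards [hsT] with x hx
    calc _ = ∫⁻ y, h x ^ 2 / s x * (L x y * s y) ∂μ := by
          congr with y; simp only [div_eq_mul_inv]; ring
      _ ≤ h x ^ 2 / s x * (Λ * s x) := by
          rw [lintegral_const_mul _ (by fun_prop)]
          gcongr
          exact hsup x
      _ = Λ * h x ^ 2 * ((s x)⁻¹ * s x) := by rw [div_eq_mul_inv]; ring
      _ = _ := by rw [ENNReal.inv_mul_cancel (hs0 x) hx, mul_one]
  have h2 : ∫⁻ x, ∫⁻ y, L x y * (h y ^ 2 * (s x / s y)) ∂μ ∂μ ≤ Λ * ∫⁻ x, h x ^ 2 ∂μ := by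
    rw [lintegral_lintegral_swap (by fun_prop)]
    simpa only [hsymm] using h1
  have h3 : 2 * ∫⁻ x, ∫⁻ y, L x y * (h x * h y) ∂μ ∂μ ≤ 2 * (Λ * ∫⁻ x, h x ^ 2 ∂μ) := by
    have hm1 : Measurable fun p : X × X => L p.1 p.2 * (h p.1 * h p.2) := by fun_prop
    calc _ = ∫⁻ x, ∫⁻ y, 2 * (L x y * (h x * h y)) ∂μ ∂μ := by
          rw [← lintegral_const_mul _ hm1.lintegral_prod_right']
          congr with x
          exact (lintegral_const_mul _ (hm1.comp (by fun_prop : Measurable fun y => (x, y)))).symm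
      _ ≤ ∫⁻ x, ∫⁻ y, (L x y * (h x ^ 2 * (s y / s x)) +
            L x y * (h y ^ 2 * (s x / s y))) ∂μ ∂μ := by
          refine lintegral_mono_ae ?_
          filter_upwards [key] with x hx using lintegral_mono_ae hx
      _ = (∫⁻ x, ∫⁻ y, L x y * (h x ^ 2 * (s y / s x)) ∂μ ∂μ) +
            ∫⁻ x, ∫⁻ y, L x y * (h y ^ 2 * (s x / s y)) ∂μ ∂μ := by
          have hm2 : Measurable fun p : X × X => L p.1 p.2 * (h p.1 ^ 2 * (s p.2 / s p.1)) := by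
            fun_prop
          rw [← lintegral_add_left hm2.lintegral_prod_right']
          congr with x
          exact lintegral_add_left (hm2.comp (by fun_prop : Measurable fun y => (x, y))) _
      _ ≤ _ := by rw [two_mul]; exact add_le_add h1 h2
  exact (ENNReal.mul_le_mul_iff_right (by simp) (by simp)).1 h3

/-- If the adjoint of an integral operator is bounded on `L²`, then so is the operator, with the
same constant, at every function whose image has finite norm. -/
theorem lintegral_sq_lintegral_le_of_adjoint {Z X : Type*} [MeasurableSpace Z] [MeasurableSpace X]
    (lam : Measure Z) (μ : Measure X) [SFinite lam] [SFinite μ] {K : Z → X → ℝ≥0∞}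
    (hK : Measurable fun p : Z × X => K p.1 p.2) {Λ : ℝ≥0∞} (hΛ0 : Λ ≠ 0) (hΛ : Λ ≠ ⊤)
    (hadj : ∀ h : X → ℝ≥0∞, Measurable h →
      ∫⁻ x, (∫⁻ y, K x y * h y ∂μ) ^ 2 ∂lam ≤ Λ * ∫⁻ y, h y ^ 2 ∂μ)
    {G : Z → ℝ≥0∞} (hG : Measurable G)
    (hfin : ∫⁻ y, (∫⁻ x, K x y * G x ∂lam) ^ 2 ∂μ ≠ ⊤) :
    ∫⁻ y, (∫⁻ x, K x y * G x ∂lam) ^ 2 ∂μ ≤ Λ * ∫⁻ x, G x ^ 2 ∂lam := by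
  set h : X → ℝ≥0∞ := fun y => ∫⁻ x, K x y * G x ∂lam with hdef
  have hKu : Measurable (Function.uncurry K) := hK
  have hh : Measurable h := Measurable.lintegral_prod_left (by fun_prop)
  set P : Z → ℝ≥0∞ := fun x => ∫⁻ y, K x y * h y ∂μ with hP
  have hPm : Measurable P := Measurable.lintegral_prod_right (by fun_prop)
  have e1 : ∫⁻ y, h y ^ 2 ∂μ = ∫⁻ x, G x * P x ∂lam := by
    calc _ = ∫⁻ y, ∫⁻ x, K x y * G x * h y ∂lam ∂μ := by
          congr with y
          rw [lintegral_mul_const _ (by fun_prop), sq]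
      _ = ∫⁻ x, ∫⁻ y, K x y * G x * h y ∂μ ∂lam := lintegral_lintegral_swap (by fun_prop)
      _ = _ := by
          congr with x
          rw [← lintegral_const_mul _ (by fun_prop)]
          congr with y; ring
  have e2 : 2 * ∫⁻ y, h y ^ 2 ∂μ ≤ Λ * ∫⁻ x, G x ^ 2 ∂lam + ∫⁻ y, h y ^ 2 ∂μ := by
    calc _ = ∫⁻ x, 2 * (G x * P x) ∂lam := by rw [e1, lintegral_const_mul _ (by fun_prop)]
      _ ≤ ∫⁻ x, (G x ^ 2 * Λ + P x ^ 2 * Λ⁻¹) ∂lam :=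
          lintegral_mono fun x => ENNReal.two_mul_mul_le_sq_mul_add_sq_mul_inv _ _ hΛ0 hΛ
      _ = Λ * ∫⁻ x, G x ^ 2 ∂lam + (∫⁻ x, P x ^ 2 ∂lam) * Λ⁻¹ := by
          rw [lintegral_add_left (by fun_prop), lintegral_mul_const _ (by fun_prop),
            lintegral_mul_const _ (by fun_prop), mul_comm]
      _ ≤ Λ * ∫⁻ x, G x ^ 2 ∂lam + (Λ * ∫⁻ y, h y ^ 2 ∂μ) * Λ⁻¹ := by
          gcongr
          exact hadj h hh
      _ = _ := by
          rw [mul_comm Λ (∫⁻ y, h y ^ 2 ∂μ), mul_assoc, ENNReal.mul_inv_cancel hΛ0 hΛ, mul_one]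
  -- here the finiteness of the left side is used, to absorb it
  rw [two_mul] at e2
  exact (ENNReal.add_le_add_iff_right hfin).1 e2

/-! ### Weights in a Morrey class -/

/-- Multiplication by a weight in the Morrey class of exponent `σ` maps a Morrey space of exponent
`q`, with defect `ε`, to the Morrey space of exponent `1` required in
`lintegral_rieszPotential_rpow_le`. -/
theorem lintegral_closedBall_mul_le {X : Type*} [PseudoMetricSpace X] [MeasurableSpace X]
    {d σ q ε : ℝ} (hσ : σ.HolderConjugate q) (ν : Measure X)
    {V h : X → ℝ≥0∞} (hV : Measurable V) (hh : Measurable h) {C A : ℝ≥0∞} {x : X} {r : ℝ}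
    (hr : 0 < r)
    (hVr : ∫⁻ y in closedBall x r, V y ^ σ ∂ν ≤ C * ENNReal.ofReal r ^ (d - σ))
    (hhr : ∫⁻ y in closedBall x r, h y ^ q ∂ν ≤ A ^ q * ENNReal.ofReal r ^ (d - ε * q)) :
    ∫⁻ y in closedBall x r, V y * h y ∂ν ≤ C ^ (1 / σ) * A * ENNReal.ofReal r ^ (d - 1 - ε) := by
  have hσ0 := hσ.pos
  have hq0 := hσ.symm.pos
  have hr0 : ENNReal.ofReal r ≠ 0 := by simpa using hr
  calc _ ≤ (∫⁻ y in closedBall x r, V y ^ σ ∂ν) ^ (1 / σ) *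
        (∫⁻ y in closedBall x r, h y ^ q ∂ν) ^ (1 / q) :=
        ENNReal.lintegral_mul_le_Lp_mul_Lq _ hσ hV.aemeasurable hh.aemeasurable
    _ ≤ (C * ENNReal.ofReal r ^ (d - σ)) ^ (1 / σ) *
        (A ^ q * ENNReal.ofReal r ^ (d - ε * q)) ^ (1 / q) := by gcongr
    _ = C ^ (1 / σ) * A * (ENNReal.ofReal r ^ ((d - σ) * (1 / σ)) *
        ENNReal.ofReal r ^ ((d - ε * q) * (1 / q))) := by
        rw [ENNReal.mul_rpow_of_nonneg _ _ (by positivity),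
          ENNReal.mul_rpow_of_nonneg _ _ (by positivity), ← ENNReal.rpow_mul, ← ENNReal.rpow_mul,
          ← ENNReal.rpow_mul, mul_one_div_cancel hq0.ne', ENNReal.rpow_one]
        ring
    _ = _ := by
        rw [← ENNReal.rpow_add _ _ hr0 (by simp)]
        congr 2
        have h1 := hσ.inv_add_inv_eq_one
        have e : (d - σ) * (1 / σ) + (d - ε * q) * (1 / q) = d * (σ⁻¹ + q⁻¹) - 1 - ε := by
          field_simp; ring
        rw [e, h1, mul_one]

theorem rieszPotential_withDensity (a : ℝ) (ν : Measure X) {V h : X → ℝ≥0∞}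
    (hV : Measurable V) (hh : Measurable h) :
    rieszPotential a (ν.withDensity V) h = rieszPotential a ν (fun y => V y * h y) := by
  funext x
  unfold rieszPotential
  have hx : Measurable (rieszKernel a x) :=
    (measurable_rieszKernel a).comp (by fun_prop : Measurable fun y : X => (x, y))
  rw [lintegral_withDensity_eq_lintegral_mul _ hV (by fun_prop)]
  congr with y
  simp only [Pi.mul_apply]; ring

theorem rieszPotential_tsum (a : ℝ) (ν : Measure X) [SFinite ν] {s : ℕ → X → ℝ≥0∞}
    (hs : ∀ k, Measurable (s k)) (x : X) :
    rieszPotential a ν (fun y => ∑' k, s k y) x = ∑' k, rieszPotential a ν (s k) x := by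
  have hx : Measurable (rieszKernel a x) :=
    (measurable_rieszKernel a).comp (by fun_prop : Measurable fun y : X => (x, y))
  unfold rieszPotential
  simp only [← ENNReal.tsum_mul_left]
  exact lintegral_tsum fun k => (hx.mul (hs k)).aemeasurable

theorem rieszPotential_const_mul (a : ℝ) (ν : Measure X) [SFinite ν] (c : ℝ≥0∞) {g : X → ℝ≥0∞}
    (hg : Measurable g) (x : X) :
    rieszPotential a ν (fun y => c * g y) x = c * rieszPotential a ν g x := by
  have hx : Measurable (rieszKernel a x) :=
    (measurable_rieszKernel a).comp (by fun_prop : Measurable fun y : X => (x, y))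
  unfold rieszPotential
  rw [← lintegral_const_mul _ (by fun_prop)]
  congr with y; ring

/-- The Riesz kernel of exponent `d` defines a form bounded on `L²(V ν)`, with a bound depending
only on the growth of `ν` and on the Morrey constant of `V`. The supersolution for Schur's test is the
Neumann series `∑ Λ^(-k) T^k 1` of the operator `T h = rieszPotential d ν (V h)`: the Morrey space
estimates make the terms decay geometrically on every ball, uniformly in `V`. -/
theorem exists_lintegral_lintegral_rieszKernel_le {d σ : ℝ} (hσ : 1 < σ) (hd : 1 ≤ d)
    (C₁ C₂ : ℝ≥0) :
    ∃ Λ : ℝ≥0, Λ ≠ 0 ∧ ∀ (ν : Measure X) [SFinite ν], ν univ ≤ C₁ →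
      (∀ x r, 0 < r → ν (closedBall x r) ≤ C₁ * ENNReal.ofReal r ^ d) →
      ∀ V : X → ℝ≥0∞, Measurable V →
      (∀ x r, 0 < r → ∫⁻ y in closedBall x r, V y ^ σ ∂ν ≤ C₂ * ENNReal.ofReal r ^ (d - σ)) →
      ∀ h : X → ℝ≥0∞, Measurable h →
      ∫⁻ x, ∫⁻ y, rieszKernel d x y * (h x * h y) ∂(ν.withDensity V) ∂(ν.withDensity V) ≤
        Λ * ∫⁻ x, h x ^ 2 ∂(ν.withDensity V) := by
  set q : ℝ := σ.conjExponent with hqdef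
  have hσq : σ.HolderConjugate q := Real.HolderConjugate.conjExponent hσ
  have hq1 : 1 < q := hσq.symm.lt
  have hq0 : 0 < q := by linarith
  -- any small `ε` serves: the proof needs `2 ε (q - 1) < 1` and `ε q ≤ d`
  set ε : ℝ := 1 / (4 * q) with hεdef
  have hε : 0 < ε := by positivity
  have hεq4 : ε * q = 1 / 4 := by rw [hεdef]; field_simp
  have hεq : 2 * ε * (q - 1) < 1 := by nlinarith
  obtain ⟨M, hM⟩ := lintegral_rieszPotential_rpow_le (X := X) (d := d) (C := C₁) hε hq1 hεq
  set N : ℝ≥0 := M * C₂ ^ (1 / σ) with hN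
  refine ⟨2 * (N + 1), by positivity, fun ν _ hνu hν V hV hVM h hh => ?_⟩
  rcases isEmpty_or_nonempty X with hX | ⟨⟨x₀⟩⟩
  · have : ν.withDensity V = 0 := by ext s; simp [Subsingleton.elim s ∅]
    simp [this]
  set μ := ν.withDensity V with hμ
  set Λ : ℝ≥0 := 2 * (N + 1) with hΛ
  have hΛ0 : (Λ : ℝ≥0∞) ≠ 0 := by
    have : Λ ≠ 0 := by positivity
    exact_mod_cast this
  let S : ℕ → X → ℝ≥0∞ := fun k => (rieszPotential d μ)^[k] fun _ => 1
  have hS0 : S 0 = fun _ => 1 := rfl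
  have hSsucc (k : ℕ) : S (k + 1) = rieszPotential d μ (S k) := Function.iterate_succ_apply' _ _ _
  have hSm (k : ℕ) : Measurable (S k) := by
    induction k with
    | zero => exact measurable_const
    | succ k ih => rw [hSsucc]; exact measurable_rieszPotential d μ ih
  -- the iterates of the constant function grow at most geometrically in a Morrey space
  set A : ℝ≥0∞ := (C₁ : ℝ≥0∞) ^ (1 / q) with hA
  have hAT : A ≠ ⊤ := by simp only [hA]; finiteness
  have hSM (k : ℕ) : ∀ x r, 0 < r → ∫⁻ y in closedBall x r, S k y ^ q ∂ν ≤
      ((N : ℝ≥0∞) ^ k * A) ^ q * ENNReal.ofReal r ^ (d - ε * q) := by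
    induction k with
    | zero =>
      intro x r hr
      have hAq : A ^ q = C₁ := by
        rw [hA, ← ENNReal.rpow_mul, one_div_mul_cancel hq0.ne', ENNReal.rpow_one]
      simp only [hS0, ENNReal.one_rpow, pow_zero, one_mul, hAq]
      rw [setLIntegral_one]
      rcases le_total r 1 with hr1 | hr1
      · refine (hν x r hr).trans ?_
        refine mul_le_mul' le_rfl ?_
        exact ENNReal.rpow_le_rpow_of_exponent_ge (ENNReal.ofReal_le_one.2 hr1) (by linarith)
      · refine (measure_mono (subset_univ _)).trans (hνu.trans ?_)
        refine le_mul_of_one_le_right' ?_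
        exact ENNReal.one_le_rpow (ENNReal.one_le_ofReal.2 hr1) (by linarith)
    | succ k ih =>
      intro x r hr
      have h1 := hM ν hν (fun y => V y * S k y) (hV.mul (hSm k))
        ((C₂ : ℝ≥0∞) ^ (1 / σ) * ((N : ℝ≥0∞) ^ k * A))
        (fun x r hr => lintegral_closedBall_mul_le hσq ν hV (hSm k) hr (hVM x r hr) (ih x r hr))
        x r hr
      rw [hSsucc, hμ, rieszPotential_withDensity d ν hV (hSm k)]
      refine h1.trans_eq ?_
      congr 2
      rw [hN, ENNReal.coe_mul, ENNReal.coe_rpow_of_nonneg _ (by positivity), pow_succ]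
      ring
  -- the Neumann series of `Λ⁻¹ T` is a supersolution
  let s : X → ℝ≥0∞ := fun x => ∑' k, (Λ : ℝ≥0∞)⁻¹ ^ k * S k x
  have hsm : Measurable s := Measurable.tsum fun k => (hSm k).const_mul _
  have hs0 (x : X) : s x ≠ 0 := by
    have h1 : (1 : ℝ≥0∞) ≤ s x := by
      refine le_trans ?_ (ENNReal.le_tsum 0)
      simp [hS0]
    exact (zero_lt_one.trans_le h1).ne'
  have hsup (x : X) : ∫⁻ y, rieszKernel d x y * s y ∂μ ≤ Λ * s x := by
    change rieszPotential d μ s x ≤ _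
    simp only [s]
    rw [rieszPotential_tsum d μ (fun k => (hSm k).const_mul _), ← ENNReal.tsum_mul_left,
      tsum_eq_zero_add' (f := fun k => (Λ : ℝ≥0∞) * _) ENNReal.summable]
    refine le_add_left (le_of_eq ?_)
    congr with k
    rw [rieszPotential_const_mul d μ _ (hSm k), hSsucc, pow_succ, ← mul_assoc,
      mul_left_comm, ENNReal.mul_inv_cancel hΛ0 (by simp), mul_one]
  have hsfin (r : ℝ) (hr : 0 < r) : ∫⁻ y in closedBall x₀ r, s y ∂μ ≠ ⊤ := by
    have h1 (k : ℕ) : ∫⁻ y in closedBall x₀ r, S k y ∂μ ≤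
        (C₂ : ℝ≥0∞) ^ (1 / σ) * ((N : ℝ≥0∞) ^ k * A) * ENNReal.ofReal r ^ (d - 1 - ε) := by
      rw [hμ, restrict_withDensity measurableSet_closedBall,
        lintegral_withDensity_eq_lintegral_mul _ hV (hSm k)]
      exact lintegral_closedBall_mul_le hσq ν hV (hSm k) hr (hVM x₀ r hr) (hSM k x₀ r hr)
    have h2 : ∫⁻ y in closedBall x₀ r, s y ∂μ ≤
        ∑' k : ℕ, (2 : ℝ≥0∞)⁻¹ ^ k *
          ((C₂ : ℝ≥0∞) ^ (1 / σ) * A * ENNReal.ofReal r ^ (d - 1 - ε)) := by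
      simp only [s]
      rw [lintegral_tsum fun k => ((hSm k).const_mul _).aemeasurable]
      refine ENNReal.tsum_le_tsum fun k => ?_
      rw [lintegral_const_mul _ (hSm k)]
      have h3 : (Λ : ℝ≥0∞)⁻¹ * N ≤ 2⁻¹ := by
        have : (Λ : ℝ≥0)⁻¹ * N ≤ 2⁻¹ := by
          rw [hΛ, inv_mul_le_iff₀ (by positivity)]
          rw [mul_comm, ← mul_assoc, inv_mul_cancel₀ (by norm_num), one_mul]
          exact le_self_add
        rw [← ENNReal.coe_inv (by positivity), ← ENNReal.coe_mul]
        refine (ENNReal.coe_le_coe.2 this).trans_eq ?_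
        simp
      calc _ ≤ (Λ : ℝ≥0∞)⁻¹ ^ k * ((C₂ : ℝ≥0∞) ^ (1 / σ) * ((N : ℝ≥0∞) ^ k * A) *
              ENNReal.ofReal r ^ (d - 1 - ε)) := by gcongr; exact h1 k
        _ = ((Λ : ℝ≥0∞)⁻¹ * N) ^ k *
              ((C₂ : ℝ≥0∞) ^ (1 / σ) * A * ENNReal.ofReal r ^ (d - 1 - ε)) := by
            rw [mul_pow]; ring
        _ ≤ _ := by gcongr
    refine ne_top_of_le_ne_top ?_ h2
    rw [ENNReal.tsum_mul_right]
    have h4 : ∑' k : ℕ, (2 : ℝ≥0∞)⁻¹ ^ k ≠ ⊤ := by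
      rw [ENNReal.tsum_geometric]; simp
    have h5 : ENNReal.ofReal r ^ (d - 1 - ε) ≠ ⊤ :=
      ENNReal.rpow_ne_top_of_ne_zero (by simpa using hr) (by simp)
    have h6 : (C₂ : ℝ≥0∞) ^ (1 / σ) ≠ ⊤ := ENNReal.rpow_ne_top_of_nonneg (by positivity) (by simp)
    exact ENNReal.mul_ne_top h4 (ENNReal.mul_ne_top (ENNReal.mul_ne_top h6 hAT) h5)
  have hsT : ∀ᵐ x ∂μ, s x ≠ ⊤ := by
    rw [← Measure.restrict_univ (μ := μ), ← iUnion_closedBall_nat x₀, ae_restrict_iUnion_iff]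
    intro k
    have h1 := hsfin (k + 1) (by positivity)
    have h2 : ∫⁻ y in closedBall x₀ k, s y ∂μ ≠ ⊤ :=
      ne_top_of_le_ne_top h1 (lintegral_mono_set (closedBall_subset_closedBall (by simp)))
    exact (ae_lt_top hsm h2).mono fun _ h => h.ne
  exact lintegral_lintegral_mul_le_of_supersolution μ (measurable_rieszKernel d)
    (rieszKernel_comm d) hsm hs0 hsT hsup hh

end Morrey

/-! ### Restriction of potentials to a subspace -/

theorem setLIntegral_Ioi_comp_mul_left {f : ℝ → ℝ≥0∞} (hf : Measurable f) {c : ℝ} (hc : 0 < c) :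
    ENNReal.ofReal c * ∫⁻ t in Ioi (0 : ℝ), f (c * t) = ∫⁻ t in Ioi (0 : ℝ), f t := by
  have h1 : ∫⁻ t in Ioi (0 : ℝ), f (c * t) = ∫⁻ t, (Ioi (0 : ℝ)).indicator f (c * t) := by
    rw [← lintegral_indicator measurableSet_Ioi]
    congr with t
    simp [indicator, hc]
  have hfi := hf.indicator (measurableSet_Ioi (a := (0 : ℝ)))
  rw [h1, ← lintegral_map hfi (measurable_const_mul c)]
  conv_rhs => rw [← lintegral_indicator measurableSet_Ioi, ← Real.smul_map_volume_mul_left hc.ne']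
  rw [lintegral_smul_measure, abs_of_pos hc, smul_eq_mul]

section

variable {Z : Type*} [PseudoMetricSpace Z] [MeasurableSpace Z] [OpensMeasurableSpace Z]
  [SecondCountableTopology Z]

/-- The composition law of Riesz kernels on a space of dimension at most `n`. In the double
integral over the radii `t` and `u`, the smaller ball bounds the measure of the intersection, and the
larger radius is at least half the distance of the centres. -/
theorem lintegral_rieszKernel_mul_rieszKernel_le (lam : Measure Z) [SFinite lam] {n : ℝ} {C : ℝ≥0}
    (hC : ∀ x t, 0 < t → lam (closedBall x t) ≤ C * ENNReal.ofReal t ^ n) (y z : Z) :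
    ∫⁻ x, rieszKernel n y x * rieszKernel n z x ∂lam ≤
      2 ^ n * C * rieszKernel (n - 1) y z := by
  set E := ENNReal.ofReal with hE
  have hE0 : ∀ {t : ℝ}, 0 < t → E t ≠ 0 := fun ht => by simpa [hE] using ht
  have hET : ∀ {t : ℝ}, E t ≠ ⊤ := by simp [hE]
  -- the part of the double integral over the scales where the first ball is the smaller one
  set J : Z → Z → ℝ≥0∞ := fun y z => ∫⁻ u in Ioi (0 : ℝ), ∫⁻ t in Ioc 0 u,
    E t ^ (-n) * E u ^ (-n) * lam (closedBall y t ∩ closedBall z u) with hJ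
  have hJle (y z : Z) : J y z ≤ 2 ^ (n - 1) * C * rieszKernel (n - 1) y z := by
    calc J y z ≤ ∫⁻ u in Ioi (0 : ℝ), C * (E u ^ (1 - n) * (closedBall y (2 * u)).indicator 1 z) := by
          refine setLIntegral_mono' measurableSet_Ioi fun u (hu : 0 < u) => ?_
          by_cases hyz : z ∈ closedBall y (2 * u)
          · calc _ ≤ ∫⁻ t in Ioc 0 u, E u ^ (-n) * C := by
                  refine setLIntegral_mono' measurableSet_Ioc fun t ht => ?_
                  calc _ ≤ E t ^ (-n) * E u ^ (-n) * (C * E t ^ n) := by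
                        gcongr
                        exact (measure_mono inter_subset_left).trans (hC y t ht.1)
                    _ = E u ^ (-n) * C * (E t ^ (-n) * E t ^ n) := by ring
                    _ = _ := by rw [← ENNReal.rpow_add _ _ (hE0 ht.1) hET]; simp
              _ = C * (E u ^ (-n) * E u ^ (1 : ℝ)) := by
                  rw [setLIntegral_const, Real.volume_Ioc, sub_zero, ENNReal.rpow_one]; ring
              _ = _ := by
                  rw [← ENNReal.rpow_add _ _ (hE0 hu) hET]
                  simp only [hyz, indicator_of_mem, Pi.one_apply, mul_one]
                  congr 2; ring
          · have : ∀ t ∈ Ioc 0 u, E t ^ (-n) * E u ^ (-n) *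
                lam (closedBall y t ∩ closedBall z u) = 0 := by
              intro t ht
              have h0 : closedBall y t ∩ closedBall z u = ∅ := by
                ext x
                simp only [mem_inter_iff, mem_closedBall, mem_empty_iff_false, iff_false, not_and]
                intro h1 h2
                apply hyz
                rw [mem_closedBall]
                linarith [dist_triangle z x y, dist_comm x z, ht.2]
              rw [h0, measure_empty, mul_zero]
            rw [setLIntegral_congr_fun measurableSet_Ioc this]
            simp
      _ = C * ∫⁻ u in Ioi (0 : ℝ), 2 ^ (n - 1) *
            (E (2 * u) ^ (-(n - 1)) * (closedBall y (2 * u)).indicator 1 z) := by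
          rw [lintegral_const_mul _ (by fun_prop)]
          congr 1
          refine lintegral_congr fun u => ?_
          rw [hE, ENNReal.ofReal_mul (by norm_num), ENNReal.ofReal_ofNat,
            ENNReal.mul_rpow_of_ne_top (by simp) (by simp), ← mul_assoc, ← mul_assoc,
            ← ENNReal.rpow_add _ _ (by simp) (by simp), add_neg_cancel, ENNReal.rpow_zero, one_mul,
            neg_sub]
      _ ≤ C * (2 ^ (n - 1) * (E 2 * ∫⁻ u in Ioi (0 : ℝ),
            (E (2 * u) ^ (-(n - 1)) * (closedBall y (2 * u)).indicator 1 z))) := by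
          rw [lintegral_const_mul _ (by fun_prop)]
          gcongr
          refine le_mul_of_one_le_left' ?_
          simp [hE]
      _ = _ := by
          rw [hE, setLIntegral_Ioi_comp_mul_left (f := fun u => ENNReal.ofReal u ^ (-(n - 1)) *
            (closedBall y u).indicator 1 z) (by fun_prop) two_pos]
          unfold rieszKernel
          ring
  set φ : ℝ → ℝ → ℝ≥0∞ := fun t u =>
    E t ^ (-n) * E u ^ (-n) * lam (closedBall y t ∩ closedBall z u) with hφ
  have hφe (t u : ℝ) : φ t u = ∫⁻ x, E t ^ (-n) * (closedBall y t).indicator 1 x *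
      (E u ^ (-n) * (closedBall z u).indicator 1 x) ∂lam := by
    have h1 : ∀ x, E t ^ (-n) * (closedBall y t).indicator 1 x *
        (E u ^ (-n) * (closedBall z u).indicator 1 x) = E t ^ (-n) * E u ^ (-n) *
          (closedBall y t ∩ closedBall z u).indicator 1 x := by
      intro x
      rw [inter_indicator_one, Pi.mul_apply]; ring
    simp only [h1]
    have hmI := measurableSet_closedBall (x := y) (ε := t) |>.inter
      (measurableSet_closedBall (x := z) (ε := u))
    rw [lintegral_const_mul _ (measurable_one.indicator hmI), lintegral_indicator_one hmI]
  have hφm : Measurable fun p : ℝ × ℝ => φ p.1 p.2 := by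
    simp only [hφe]
    exact Measurable.lintegral_prod_right (by fun_prop)
  have hsum : ∫⁻ x, rieszKernel n y x * rieszKernel n z x ∂lam =
      ∫⁻ t in Ioi (0 : ℝ), ∫⁻ u in Ioi (0 : ℝ), φ t u := by
    calc _ = ∫⁻ x, ∫⁻ t in Ioi (0 : ℝ), ∫⁻ u in Ioi (0 : ℝ),
          E t ^ (-n) * (closedBall y t).indicator 1 x *
            (E u ^ (-n) * (closedBall z u).indicator 1 x) ∂volume ∂volume ∂lam := by
          refine lintegral_congr fun x => ?_
          unfold rieszKernel
          rw [← lintegral_mul_const _ (by fun_prop)]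
          refine lintegral_congr fun t => ?_
          rw [← lintegral_const_mul _ (by fun_prop)]
      _ = ∫⁻ t in Ioi (0 : ℝ), ∫⁻ x, ∫⁻ u in Ioi (0 : ℝ),
          E t ^ (-n) * (closedBall y t).indicator 1 x *
            (E u ^ (-n) * (closedBall z u).indicator 1 x) ∂volume ∂lam := by
          refine lintegral_lintegral_swap (Measurable.aemeasurable ?_)
          exact Measurable.lintegral_prod_right (by fun_prop)
      _ = _ := by
          refine lintegral_congr fun t => ?_
          simp only [hφe]
          exact lintegral_lintegral_swap (by fun_prop)
  have hsplit (t : ℝ) (ht : t ∈ Ioi (0 : ℝ)) : ∫⁻ u in Ioi (0 : ℝ), φ t u ≤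
      (∫⁻ u in Ioc 0 t, φ t u) + ∫⁻ u in Ioi (0 : ℝ), (Ici t).indicator (φ t) u := by
    rw [setLIntegral_indicator measurableSet_Ici]
    have : Ioi (0 : ℝ) ⊆ Ioc 0 t ∪ (Ici t ∩ Ioi 0) := fun u hu =>
      (le_total u t).imp (fun h => ⟨hu, h⟩) fun h => ⟨h, hu⟩
    exact (lintegral_mono_set this).trans (lintegral_union_le _ _ _)
  have e1 : ∫⁻ t in Ioi (0 : ℝ), ∫⁻ u in Ioc 0 t, φ t u = J z y := by
    refine lintegral_congr fun t => lintegral_congr fun u => ?_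
    simp only [hφ, inter_comm (closedBall y t), mul_comm (E t ^ (-n))]
  have hind : Measurable fun p : ℝ × ℝ => (Ici p.1).indicator (φ p.1) p.2 := by
    have : MeasurableSet {p : ℝ × ℝ | p.1 ≤ p.2} := measurableSet_le measurable_fst measurable_snd
    exact hφm.indicator this
  have e2 : ∫⁻ t in Ioi (0 : ℝ), ∫⁻ u in Ioi (0 : ℝ), (Ici t).indicator (φ t) u = J y z := by
    rw [lintegral_lintegral_swap hind.aemeasurable]
    refine lintegral_congr fun u => ?_
    have h1 (t : ℝ) : (Ici t).indicator (φ t) u = (Iic u).indicator (fun t => φ t u) t := by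
      simp [indicator]
    simp only [h1]
    rw [setLIntegral_indicator measurableSet_Iic, inter_comm, Ioi_inter_Iic]
  have hm1 : Measurable fun t => ∫⁻ u in Ioi (0 : ℝ), (Ici t).indicator (φ t) u :=
    Measurable.lintegral_prod_right hind
  calc _ = ∫⁻ t in Ioi (0 : ℝ), ∫⁻ u in Ioi (0 : ℝ), φ t u := hsum
    _ ≤ ∫⁻ t in Ioi (0 : ℝ), ((∫⁻ u in Ioc 0 t, φ t u) +
          ∫⁻ u in Ioi (0 : ℝ), (Ici t).indicator (φ t) u) :=
        setLIntegral_mono' measurableSet_Ioi hsplit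
    _ = J z y + J y z := by rw [lintegral_add_right _ hm1, e1, e2]
    _ ≤ 2 ^ (n - 1) * C * rieszKernel (n - 1) z y + 2 ^ (n - 1) * C * rieszKernel (n - 1) y z :=
        add_le_add (hJle z y) (hJle y z)
    _ = 2 ^ (1 : ℝ) * 2 ^ (n - 1) * C * rieszKernel (n - 1) y z := by
        rw [rieszKernel_comm _ z y, ENNReal.rpow_one]; ring
    _ = _ := by
        rw [← ENNReal.rpow_add _ _ (by simp) (by simp), add_sub_cancel]

theorem rieszPotential_le_of_bounded (lam : Measure Z) [SFinite lam] {n : ℝ} (hn : 1 < n) {C : ℝ≥0}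
    (hC : ∀ x t, 0 < t → lam (closedBall x t) ≤ C * ENNReal.ofReal t ^ n) {G : Z → ℝ≥0∞}
    (hG : Measurable G) {B : ℝ≥0∞} (hB : ∀ x, G x ≤ B) (x : Z) :
    rieszPotential n lam G x ≤ B * C + ENNReal.ofReal (n - 1)⁻¹ * ∫⁻ z, G z ∂lam := by
  rw [rieszPotential_eq_lintegral_closedBall n lam hG, ← Ioc_union_Ioi_eq_Ioi zero_le_one,
    lintegral_union measurableSet_Ioi (Ioc_disjoint_Ioi le_rfl)]
  gcongr
  · calc _ ≤ ∫⁻ t in Ioc (0 : ℝ) 1, B * C := by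
          refine setLIntegral_mono' measurableSet_Ioc fun t ht => ?_
          have ht0 : ENNReal.ofReal t ≠ 0 := by simpa using ht.1
          calc _ ≤ ENNReal.ofReal t ^ (-n) * (B * (C * ENNReal.ofReal t ^ n)) := by
                gcongr
                calc _ ≤ ∫⁻ z in closedBall x t, B ∂lam := lintegral_mono fun z => hB z
                  _ ≤ _ := by rw [setLIntegral_const]; gcongr; exact hC x t ht.1
            _ = B * C * (ENNReal.ofReal t ^ (-n) * ENNReal.ofReal t ^ n) := by ring
            _ = _ := by rw [← ENNReal.rpow_add _ _ ht0 (by simp)]; simp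
      _ = _ := by simp
  · calc _ ≤ ∫⁻ t in Ioi (1 : ℝ), ENNReal.ofReal t ^ (-n) * ∫⁻ z, G z ∂lam := by
          exact lintegral_mono fun t => mul_le_mul' le_rfl (setLIntegral_le_lintegral _ _)
      _ = _ := by
          rw [lintegral_mul_const _ (by fun_prop), lintegral_Ioi_ofReal_rpow (by linarith) one_pos]
          simp [sub_eq_add_neg, add_comm]

/-- The norm of the adjoint of the operator which restricts potentials to a subspace `X` is computed
by a Riesz kernel on `X`, of exponent smaller by one. -/
theorem lintegral_sq_lintegral_rieszKernel_comp_le {X : Type*} [PseudoMetricSpace X]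
    [MeasurableSpace X] [OpensMeasurableSpace X] [SecondCountableTopology X] {ι : X → Z}
    (hι : Isometry ι) (hιm : Measurable ι) (lam : Measure Z) [SFinite lam] {n : ℝ} {C : ℝ≥0}
    (hC : ∀ x t, 0 < t → lam (closedBall x t) ≤ C * ENNReal.ofReal t ^ n)
    (μ : Measure X) [SFinite μ] {h : X → ℝ≥0∞} (hh : Measurable h) :
    ∫⁻ x, (∫⁻ y, rieszKernel n (ι y) x * h y ∂μ) ^ 2 ∂lam ≤
      2 ^ n * C * ∫⁻ y, ∫⁻ z, rieszKernel (n - 1) y z * (h y * h z) ∂μ ∂μ := by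
  have hKι (y z : X) (a : ℝ) : rieszKernel a (ι y) (ι z) = rieszKernel a y z := by
    simp [rieszKernel, indicator, hι.dist_eq]
  have hKm : Measurable fun p : X × Z => rieszKernel n (ι p.1) p.2 :=
    (measurable_rieszKernel n).comp (by fun_prop : Measurable fun p : X × Z => (ι p.1, p.2))
  have hK1 (x : Z) : Measurable fun y => rieszKernel n (ι y) x :=
    hKm.comp (by fun_prop : Measurable fun y => (y, x))
  have hK2 (y : X) : Measurable fun x => rieszKernel n (ι y) x :=
    hKm.comp (by fun_prop : Measurable fun x => (y, x))
  have hm3 : Measurable fun p : (Z × X) × X => rieszKernel n (ι p.1.2) p.1.1 * h p.1.2 *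
      (rieszKernel n (ι p.2) p.1.1 * h p.2) :=
    ((hKm.comp (by fun_prop : Measurable fun p : (Z × X) × X => (p.1.2, p.1.1))).mul
      (by fun_prop)).mul
      ((hKm.comp (by fun_prop : Measurable fun p : (Z × X) × X => (p.2, p.1.1))).mul
      (by fun_prop))
  have hm4 (y : X) : Measurable fun p : Z × X => rieszKernel n (ι y) p.1 * h y *
      (rieszKernel n (ι p.2) p.1 * h p.2) :=
    hm3.comp (by fun_prop : Measurable fun p : Z × X => ((p.1, y), p.2))
  have hmL : Measurable fun p : X × X => rieszKernel (n - 1) p.1 p.2 * (h p.1 * h p.2) :=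
    (measurable_rieszKernel (n - 1)).mul (by fun_prop)
  calc _ = ∫⁻ x, ∫⁻ y, ∫⁻ z, rieszKernel n (ι y) x * h y *
        (rieszKernel n (ι z) x * h z) ∂μ ∂μ ∂lam := by
        refine lintegral_congr fun x => ?_
        have hx : Measurable fun y => rieszKernel n (ι y) x * h y := (hK1 x).mul hh
        rw [sq, ← lintegral_mul_const _ hx]
        refine lintegral_congr fun y => ?_
        rw [← lintegral_const_mul _ hx]
    _ = ∫⁻ y, ∫⁻ z, ∫⁻ x, rieszKernel n (ι y) x * h y *
        (rieszKernel n (ι z) x * h z) ∂lam ∂μ ∂μ := by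
        rw [lintegral_lintegral_swap hm3.lintegral_prod_right'.aemeasurable]
        refine lintegral_congr fun y => ?_
        exact lintegral_lintegral_swap (hm4 y).aemeasurable
    _ ≤ ∫⁻ y, ∫⁻ z, 2 ^ n * C * (rieszKernel (n - 1) y z * (h y * h z)) ∂μ ∂μ := by
        refine lintegral_mono fun y => lintegral_mono fun z => ?_
        calc _ = ∫⁻ x, (rieszKernel n (ι y) x * rieszKernel n (ι z) x) * (h y * h z) ∂lam := by
              refine lintegral_congr fun x => ?_
              ring
          _ = (∫⁻ x, rieszKernel n (ι y) x * rieszKernel n (ι z) x ∂lam) * (h y * h z) :=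
              lintegral_mul_const _ ((hK2 y).mul (hK2 z))
          _ ≤ 2 ^ n * C * rieszKernel (n - 1) (ι y) (ι z) * (h y * h z) := by
              gcongr
              exact lintegral_rieszKernel_mul_rieszKernel_le lam hC (ι y) (ι z)
          _ = _ := by rw [hKι]; ring
    _ = _ := by
        rw [← lintegral_const_mul _ hmL.lintegral_prod_right']
        refine lintegral_congr fun y => ?_
        exact lintegral_const_mul _ (hmL.comp (by fun_prop : Measurable fun z => (y, z)))

/-- Trace inequality for potentials: boundedness of the form of the Riesz kernel on `L²(μ)` implies
that the restriction of potentials to `X` is bounded from `L²` to `L²(μ)`. Boundedness and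
integrability of `G` enter only to know beforehand that the left side is finite. -/
theorem lintegral_sq_rieszPotential_comp_le {X : Type*} [PseudoMetricSpace X] [MeasurableSpace X]
    [OpensMeasurableSpace X] [SecondCountableTopology X] {ι : X → Z} (hι : Isometry ι)
    (hιm : Measurable ι)
    (lam : Measure Z) [SFinite lam] {n : ℝ} (hn : 1 < n) {C : ℝ≥0} (hC0 : C ≠ 0)
    (hC : ∀ x t, 0 < t → lam (closedBall x t) ≤ C * ENNReal.ofReal t ^ n)
    (μ : Measure X) [IsFiniteMeasure μ] {Λ : ℝ≥0} (hΛ : Λ ≠ 0)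
    (hμ : ∀ h : X → ℝ≥0∞, Measurable h →
      ∫⁻ x, ∫⁻ y, rieszKernel (n - 1) x y * (h x * h y) ∂μ ∂μ ≤ Λ * ∫⁻ x, h x ^ 2 ∂μ)
    {G : Z → ℝ≥0∞} (hG : Measurable G) {B : ℝ≥0∞} (hBT : B ≠ ⊤) (hB : ∀ x, G x ≤ B)
    (hGi : ∫⁻ z, G z ∂lam ≠ ⊤) :
    ∫⁻ y, rieszPotential n lam G (ι y) ^ 2 ∂μ ≤
      2 ^ n * C * Λ * ∫⁻ z, G z ^ 2 ∂lam := by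
  have h2n0 : (2 : ℝ≥0∞) ^ n ≠ 0 := by simp
  have h2nT : (2 : ℝ≥0∞) ^ n ≠ ⊤ := ENNReal.rpow_ne_top_of_ne_zero (by simp) (by simp)
  have hKm : Measurable fun p : Z × X => rieszKernel n (ι p.2) p.1 :=
    (measurable_rieszKernel n).comp (by fun_prop : Measurable fun p : Z × X => (ι p.2, p.1))
  have hΛ0 : (2 : ℝ≥0∞) ^ n * C * Λ ≠ 0 :=
    mul_ne_zero (mul_ne_zero h2n0 (by exact_mod_cast hC0)) (by exact_mod_cast hΛ)
  have hΛT : (2 : ℝ≥0∞) ^ n * C * Λ ≠ ⊤ :=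
    ENNReal.mul_ne_top (ENNReal.mul_ne_top h2nT ENNReal.coe_ne_top) ENNReal.coe_ne_top
  have hfin : ∫⁻ y, rieszPotential n lam G (ι y) ^ 2 ∂μ ≠ ⊤ := by
    set b : ℝ≥0∞ := B * C + ENNReal.ofReal (n - 1)⁻¹ * ∫⁻ z, G z ∂lam with hb
    have hbT : b ≠ ⊤ := by
      rw [hb]
      exact ENNReal.add_ne_top.2 ⟨ENNReal.mul_ne_top hBT ENNReal.coe_ne_top,
        ENNReal.mul_ne_top ENNReal.ofReal_ne_top hGi⟩
    have hle : ∫⁻ y, rieszPotential n lam G (ι y) ^ 2 ∂μ ≤ ∫⁻ _, b ^ 2 ∂μ :=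
      lintegral_mono fun y =>
        pow_le_pow_left' (rieszPotential_le_of_bounded lam hn hC hG hB (ι y)) 2
    refine ne_top_of_le_ne_top ?_ hle
    rw [lintegral_const]
    exact ENNReal.mul_ne_top (ENNReal.pow_ne_top hbT) (measure_ne_top _ _)
  refine lintegral_sq_lintegral_le_of_adjoint lam μ (K := fun x y => rieszKernel n (ι y) x)
    hKm hΛ0 hΛT (fun h hh => ?_) hG hfin
  refine (lintegral_sq_lintegral_rieszKernel_comp_le hι hιm lam hC μ hh).trans ?_
  rw [mul_assoc _ (Λ : ℝ≥0∞)]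
  exact mul_le_mul' le_rfl (hμ h hh)

end

/-! ### Surface measure on the sphere -/

section Polar

variable {E : Type*} [NormedAddCommGroup E] [NormedSpace ℝ E] [FiniteDimensional ℝ E]
  [MeasurableSpace E] [BorelSpace E] (lam : Measure E) [lam.IsAddHaarMeasure]

/-- Integration in polar coordinates. -/
theorem lintegral_eq_lintegral_toSphere [Nontrivial E] {f : E → ℝ≥0∞} (hf : Measurable f) :
    ∫⁻ x, f x ∂lam = ∫⁻ y : sphere (0 : E) 1, ∫⁻ t in Ioi (0 : ℝ),
      ENNReal.ofReal (t ^ (Module.finrank ℝ E - 1)) * f (t • (y : E)) ∂volume ∂lam.toSphere := by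
  have hsm : Measurable fun p : sphere (0 : E) 1 × ℝ => p.2 • (p.1 : E) := by
    apply Continuous.measurable; fun_prop
  calc ∫⁻ x, f x ∂lam = ∫⁻ x in ({0}ᶜ : Set E), f x ∂lam := by rw [restrict_compl_singleton]
    _ = ∫⁻ x : ({0}ᶜ : Set E), f x ∂(lam.comap (↑)) :=
        (lintegral_subtype_comap (measurableSet_singleton _).compl f).symm
    _ = ∫⁻ p, f ((p.2 : ℝ) • (p.1 : E))
          ∂(lam.toSphere.prod (Measure.volumeIoiPow (Module.finrank ℝ E - 1))) := by
        rw [← lam.measurePreserving_homeomorphUnitSphereProd.lintegral_comp_emb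
          (Homeomorph.measurableEmbedding _)]
        refine lintegral_congr fun x => ?_
        have hx : ‖(x : E)‖ ≠ 0 := norm_ne_zero_iff.2 x.2
        simp [smul_smul, hx]
    _ = ∫⁻ y : sphere (0 : E) 1, ∫⁻ t, f ((t : ℝ) • (y : E))
          ∂(Measure.volumeIoiPow (Module.finrank ℝ E - 1)) ∂lam.toSphere := by
        rw [lintegral_prod]
        exact (hf.comp (hsm.comp (by fun_prop : Measurable
          fun p : sphere (0 : E) 1 × Ioi (0 : ℝ) => (p.1, (p.2 : ℝ))))).aemeasurable
    _ = _ := by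
        refine lintegral_congr fun y => ?_
        have hfy : Measurable fun t : ℝ => f (t • (y : E)) :=
          hf.comp (hsm.comp (by fun_prop : Measurable fun t : ℝ => (y, t)))
        have hfy' : Measurable fun t : Ioi (0 : ℝ) => f ((t : ℝ) • (y : E)) :=
          hfy.comp measurable_subtype_coe
        rw [Measure.volumeIoiPow, lintegral_withDensity_eq_lintegral_mul _ (by fun_prop) hfy']
        exact lintegral_subtype_comap measurableSet_Ioi
          fun t : ℝ => ENNReal.ofReal (t ^ (Module.finrank ℝ E - 1)) * f (t • (y : E))

/-- Upper growth bound for the surface measure: the shell of thickness `r` outside a spherical cap of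
radius `r` is contained in a ball of radius `2 r`. -/
theorem toSphere_closedBall_le [Nontrivial E] (y : sphere (0 : E) 1) {r : ℝ} (hr : 0 < r) :
    lam.toSphere (closedBall y r) ≤ 2 ^ Module.finrank ℝ E * lam (ball 0 1) *
      ENNReal.ofReal r ^ ((Module.finrank ℝ E : ℝ) - 1) := by
  have hr0 : ENNReal.ofReal r ≠ 0 := by simpa using hr
  have h1 : lam.toSphere (closedBall y r) * ENNReal.ofReal r ≤
      ENNReal.ofReal (2 * r) ^ Module.finrank ℝ E * lam (ball 0 1) := by
    calc _ = ∫⁻ z in closedBall y r, ENNReal.ofReal r ∂lam.toSphere := by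
          rw [setLIntegral_const, mul_comm]
      _ ≤ ∫⁻ z in closedBall y r, ∫⁻ t in Ioi (0 : ℝ),
            ENNReal.ofReal (t ^ (Module.finrank ℝ E - 1)) *
              (closedBall (y : E) (2 * r)).indicator 1 (t • (z : E)) ∂volume ∂lam.toSphere := by
          refine setLIntegral_mono' measurableSet_closedBall fun z hz => ?_
          calc ENNReal.ofReal r = ∫⁻ t in Ioc (1 : ℝ) (1 + r), 1 := by simp
            _ ≤ ∫⁻ t in Ioc (1 : ℝ) (1 + r), ENNReal.ofReal (t ^ (Module.finrank ℝ E - 1)) *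
                  (closedBall (y : E) (2 * r)).indicator 1 (t • (z : E)) := by
                refine setLIntegral_mono' measurableSet_Ioc fun t ht => ?_
                have hmem : t • (z : E) ∈ closedBall (y : E) (2 * r) := by
                  have hzy : dist (z : E) y ≤ r := hz
                  have htz : dist (t • (z : E)) z ≤ r := by
                    have : t • (z : E) - z = (t - 1) • (z : E) := by rw [sub_smul, one_smul]
                    rw [dist_eq_norm, this, norm_smul, norm_eq_of_mem_sphere z, mul_one,
                      Real.norm_of_nonneg (by linarith [ht.1])]
                    linarith [ht.2]
                  rw [mem_closedBall]
                  linarith [dist_triangle (t • (z : E)) z y]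
                rw [indicator_of_mem hmem, Pi.one_apply, mul_one]
                exact ENNReal.one_le_ofReal.2 (one_le_pow₀ ht.1.le)
            _ ≤ _ := lintegral_mono_set fun t ht => zero_lt_one.trans ht.1
      _ ≤ ∫⁻ z : sphere (0 : E) 1, ∫⁻ t in Ioi (0 : ℝ),
            ENNReal.ofReal (t ^ (Module.finrank ℝ E - 1)) *
              (closedBall (y : E) (2 * r)).indicator 1 (t • (z : E)) ∂volume ∂lam.toSphere :=
          setLIntegral_le_lintegral _ _
      _ = lam (closedBall (y : E) (2 * r)) := by
          rw [← lintegral_eq_lintegral_toSphere lam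
            (measurable_one.indicator measurableSet_closedBall),
            lintegral_indicator_one measurableSet_closedBall]
      _ = _ := by
          rw [Measure.addHaar_closedBall _ _ (by positivity), ENNReal.ofReal_pow (by positivity)]
  calc lam.toSphere (closedBall y r)
      = lam.toSphere (closedBall y r) * ENNReal.ofReal r * ENNReal.ofReal r ^ (-1 : ℝ) := by
        rw [mul_assoc]
        nth_rw 1 [← ENNReal.rpow_one (ENNReal.ofReal r)]
        rw [← ENNReal.rpow_add _ _ hr0 (by simp)]
        simp
    _ ≤ ENNReal.ofReal (2 * r) ^ Module.finrank ℝ E * lam (ball 0 1) *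
          ENNReal.ofReal r ^ (-1 : ℝ) := by gcongr
    _ = 2 ^ Module.finrank ℝ E * lam (ball 0 1) *
          (ENNReal.ofReal r ^ (Module.finrank ℝ E : ℝ) * ENNReal.ofReal r ^ (-1 : ℝ)) := by
        rw [ENNReal.ofReal_mul (by norm_num), mul_pow, ENNReal.rpow_natCast]
        simp; ring
    _ = _ := by rw [← ENNReal.rpow_add _ _ hr0 (by simp), sub_eq_add_neg]

theorem lintegral_comp_homothety (y : E) {c : ℝ} (hc : 0 < c) {f : E → ℝ≥0∞} (hf : Measurable f) :
    ∫⁻ z, f (y + c • (z - y)) ∂lam =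
      ENNReal.ofReal c ^ (-(Module.finrank ℝ E : ℝ)) * ∫⁻ x, f x ∂lam := by
  have hf' : Measurable fun x => f (y + x) := hf.comp (measurable_const_add y)
  calc _ = ∫⁻ z, f (y + c • z) ∂lam :=
        lintegral_sub_right_eq_self (μ := lam) (fun z => f (y + c • z)) y
    _ = ∫⁻ x, f (y + x) ∂(lam.map (c • ·)) :=
        (lintegral_map hf' (measurable_const_smul c)).symm
    _ = ENNReal.ofReal (c ^ Module.finrank ℝ E)⁻¹ * ∫⁻ x, f (y + x) ∂lam := by
        rw [Measure.map_addHaar_smul _ hc.ne', lintegral_smul_measure, abs_of_pos (by positivity),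
          smul_eq_mul]
    _ = _ := by
        rw [lintegral_add_left_eq_self (μ := lam) f y, ENNReal.ofReal_inv_of_pos (by positivity),
          ENNReal.ofReal_pow hc.le, ENNReal.rpow_neg, ENNReal.rpow_natCast]

end Polar

/-! ### Representation of functions on the ball by their gradients -/

theorem uniqueDiffOn_closedBall_one {E : Type*} [NormedAddCommGroup E] [NormedSpace ℝ E] :
    UniqueDiffOn ℝ (closedBall (0 : E) 1) :=
  uniqueDiffOn_convex (convex_closedBall _ _)
    ⟨0, ball_subset_interior_closedBall (by simp)⟩

section Gradient

variable {E : Type*} [NormedAddCommGroup E] [InnerProductSpace ℝ E] [CompleteSpace E]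

theorem norm_gradientWithin_eq (F : E → ℝ) (s : Set E) (x : E) :
    ‖gradientWithin F s x‖ = ‖fderivWithin ℝ F s x‖ := by
  simp [gradientWithin]

theorem enorm_gradientWithin_eq (F : E → ℝ) (s : Set E) (x : E) :
    ‖gradientWithin F s x‖ₑ = ‖fderivWithin ℝ F s x‖ₑ := by
  rw [← ofReal_norm, ← ofReal_norm, norm_gradientWithin_eq]

theorem ContDiffOn.continuousOn_gradientWithin {F : E → ℝ} {s : Set E} {m : ℕ∞ω}
    (hF : ContDiffOn ℝ m F s) (hs : UniqueDiffOn ℝ s) (hm : 1 ≤ m) :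
    ContinuousOn (gradientWithin F s) s :=
  (InnerProductSpace.toDual ℝ E).symm.continuous.comp_continuousOn
    (hF.continuousOn_fderivWithin hs hm)

/-- Fundamental theorem of calculus along a segment contained in `s`; its end points may lie on the
boundary of `s`. -/
theorem enorm_sub_le_lintegral_gradientWithin {F : E → ℝ} {s : Set E} {m : ℕ∞ω}
    (hF : ContDiffOn ℝ m F s) (hs : UniqueDiffOn ℝ s) (hm : 1 ≤ m) (x v : E) {a b : ℝ}
    (hab : a ≤ b) (hmem : ∀ t ∈ Icc a b, x + t • v ∈ s) :
    ‖F (x + b • v) - F (x + a • v)‖ₑ ≤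
      ‖v‖ₑ * ∫⁻ t in Ioc a b, ‖gradientWithin F s (x + t • v)‖ₑ := by
  set γ : ℝ → E := fun t => x + t • v with hγ
  have hγd (t : ℝ) : HasDerivAt γ v t := by
    simpa [hγ] using (hasDerivAt_id t).smul_const v
  have hγc : Continuous γ := by fun_prop
  have hdiff : DifferentiableOn ℝ F s := hF.differentiableOn (by positivity)
  have hF' : ContinuousOn (fderivWithin ℝ F s) s := hF.continuousOn_fderivWithin hs hm
  have hder : ∀ t ∈ Ioo a b, HasDerivAt (fun t => F (γ t)) (fderivWithin ℝ F s (γ t) v) t := by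
    intro t ht
    have h1 := (hdiff (γ t) (hmem t (Ioo_subset_Icc_self ht))).hasFDerivWithinAt
    have h2 := h1.comp_hasDerivWithinAt t (hγd t).hasDerivWithinAt hmem
    exact h2.hasDerivAt (Icc_mem_nhds ht.1 ht.2)
  have hcont : ContinuousOn (fun t => fderivWithin ℝ F s (γ t) v) (Icc a b) :=
    (hF'.comp hγc.continuousOn hmem).clm_apply continuousOn_const
  have hint : IntervalIntegrable (fun t => fderivWithin ℝ F s (γ t) v) volume a b := by
    apply ContinuousOn.intervalIntegrable
    rwa [uIcc_of_le hab]
  have hftc := intervalIntegral.integral_eq_sub_of_hasDerivAt_of_le hab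
    (hF.continuousOn.comp hγc.continuousOn hmem) hder hint
  rw [intervalIntegral.integral_of_le hab] at hftc
  calc _ = ‖∫ t in Ioc a b, fderivWithin ℝ F s (γ t) v‖ₑ := by rw [hftc]; rfl
    _ ≤ ∫⁻ t in Ioc a b, ‖fderivWithin ℝ F s (γ t) v‖ₑ := enorm_integral_le_lintegral_enorm _
    _ ≤ ∫⁻ t in Ioc a b, ‖v‖ₑ * ‖gradientWithin F s (γ t)‖ₑ := by
        refine lintegral_mono fun t => ?_
        rw [enorm_gradientWithin_eq, mul_comm]
        exact (fderivWithin ℝ F s (γ t)).le_opENorm v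
    _ = _ := lintegral_const_mul' _ _ enorm_ne_top

end Gradient

theorem measurable_indicator_closedBall_enorm {E W : Type*} [NormedAddCommGroup E]
    [MeasurableSpace E] [BorelSpace E] [NormedAddCommGroup W] {f : E → W}
    {x : E} {r : ℝ} (hf : ContinuousOn f (closedBall x r)) :
    Measurable ((closedBall x r).indicator fun z => ‖f z‖ₑ) := by
  classical
  rw [← piecewise_eq_indicator]
  exact (continuous_enorm.comp_continuousOn hf).measurable_piecewise continuousOn_const
    measurableSet_closedBall

section Ball

variable {E : Type*} [NormedAddCommGroup E] [InnerProductSpace ℝ E] [FiniteDimensional ℝ E]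
  [MeasurableSpace E] [BorelSpace E] (lam : Measure E) [lam.IsAddHaarMeasure]

variable {F : E → ℝ} {m : ℕ∞ω}

theorem measurable_indicator_enorm_gradientWithin (hF : ContDiffOn ℝ m F (closedBall 0 1))
    (hm : 1 ≤ m) : Measurable ((closedBall (0 : E) 1).indicator
      fun x => ‖gradientWithin F (closedBall 0 1) x‖ₑ) :=
  measurable_indicator_closedBall_enorm
    (hF.continuousOn_gradientWithin uniqueDiffOn_closedBall_one hm)

/-- The `L¹` norm on the ball is controlled by the trace and the gradient, by integration along
radii. -/
theorem lintegral_enorm_closedBall_le [Nontrivial E] (hF : ContDiffOn ℝ m F (closedBall 0 1))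
    (hm : 1 ≤ m) :
    ∫⁻ x in closedBall 0 1, ‖F x‖ₑ ∂lam ≤ (∫⁻ y : sphere (0 : E) 1, ‖F y‖ₑ ∂lam.toSphere) +
      ∫⁻ x in closedBall 0 1, ‖gradientWithin F (closedBall 0 1) x‖ₑ ∂lam := by
  set B := closedBall (0 : E) 1 with hB
  set k := Module.finrank ℝ E - 1
  set G := B.indicator fun x => ‖gradientWithin F B x‖ₑ with hGdef
  have hG : Measurable G := measurable_indicator_enorm_gradientWithin hF hm
  set H := B.indicator fun x => ‖F x‖ₑ with hHdef
  have hH : Measurable H := measurable_indicator_closedBall_enorm hF.continuousOn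
  have hmemB (y : sphere (0 : E) 1) {t : ℝ} (ht : 0 < t) : t • (y : E) ∈ B ↔ t ≤ 1 := by
    rw [hB, mem_closedBall_zero_iff, norm_smul, norm_eq_of_mem_sphere y, mul_one,
      Real.norm_of_nonneg ht.le]
  have hFy : Measurable fun y : sphere (0 : E) 1 => ‖F y‖ₑ :=
    (continuous_enorm.comp (hF.continuousOn.comp_continuous continuous_subtype_val
      fun y => sphere_subset_closedBall y.2)).measurable
  have hray (y : sphere (0 : E) 1) :
      ∫⁻ t in Ioi (0 : ℝ), ENNReal.ofReal (t ^ k) * H (t • (y : E)) ≤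
        ‖F y‖ₑ + ∫⁻ t in Ioi (0 : ℝ), ENNReal.ofReal (t ^ k) * G (t • (y : E)) := by
    have h0 : ∫⁻ t in Ioi (0 : ℝ), ENNReal.ofReal (t ^ k) * H (t • (y : E)) ≤
        ∫⁻ t in Ioc (0 : ℝ) 1, ENNReal.ofReal (t ^ k) * H (t • (y : E)) := by
      rw [← Ioc_union_Ioi_eq_Ioi zero_le_one, lintegral_union measurableSet_Ioi
        (Ioc_disjoint_Ioi le_rfl)]
      have : ∫⁻ t in Ioi (1 : ℝ), ENNReal.ofReal (t ^ k) * H (t • (y : E)) = 0 := by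
        rw [← lintegral_zero (μ := volume.restrict (Ioi (1 : ℝ)))]
        refine setLIntegral_congr_fun measurableSet_Ioi fun t ht => ?_
        have hnot : t • (y : E) ∉ B := by
          rw [hmemB y (zero_lt_one.trans ht)]
          exact not_le.2 ht
        simp [hHdef, hnot]
      rw [this, add_zero]
    refine h0.trans ?_
    calc _ ≤ ∫⁻ t in Ioc (0 : ℝ) 1, (‖F y‖ₑ +
          ∫⁻ t in Ioi (0 : ℝ), ENNReal.ofReal (t ^ k) * G (t • (y : E))) := by
          refine setLIntegral_mono' measurableSet_Ioc fun t ht => ?_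
          have hsub : ∀ s ∈ Icc t 1, (0 : E) + s • (y : E) ∈ B := fun s hs => by
            rw [zero_add, hmemB y (ht.1.trans_le hs.1)]
            exact hs.2
          have h1 := enorm_sub_le_lintegral_gradientWithin hF uniqueDiffOn_closedBall_one hm 0
            (y : E) ht.2 hsub
          simp only [zero_add, one_smul] at h1
          have hy1 : ‖(y : E)‖ₑ = 1 := by
            rw [← ofReal_norm, norm_eq_of_mem_sphere y, ENNReal.ofReal_one]
          rw [hy1, one_mul] at h1
          have ht1 : ENNReal.ofReal (t ^ k) ≤ 1 :=
            ENNReal.ofReal_le_one.2 (pow_le_one₀ ht.1.le ht.2)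
          have hHt : H (t • (y : E)) ≤ ‖F y‖ₑ + ∫⁻ s in Ioc t 1, G (s • (y : E)) := by
            rw [hHdef, indicator_of_mem ((hmemB y ht.1).2 ht.2)]
            calc ‖F (t • (y : E))‖ₑ = ‖F y - (F y - F (t • (y : E)))‖ₑ := by rw [sub_sub_cancel]
              _ ≤ ‖F y‖ₑ + ‖F y - F (t • (y : E))‖ₑ := enorm_sub_le
              _ ≤ _ := by
                  gcongr
                  refine h1.trans (setLIntegral_mono' measurableSet_Ioc fun s hs => ?_)
                  rw [hGdef, indicator_of_mem ((hmemB y (ht.1.trans hs.1)).2 hs.2)]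
          calc _ ≤ ENNReal.ofReal (t ^ k) * (‖F y‖ₑ + ∫⁻ s in Ioc t 1, G (s • (y : E))) := by
                gcongr
            _ ≤ 1 * ‖F y‖ₑ + ∫⁻ s in Ioc t 1, ENNReal.ofReal (t ^ k) * G (s • (y : E)) := by
                rw [mul_add, lintegral_const_mul' _ _ ENNReal.ofReal_ne_top]
                gcongr
            _ ≤ ‖F y‖ₑ + ∫⁻ s in Ioc t 1, ENNReal.ofReal (s ^ k) * G (s • (y : E)) := by
                rw [one_mul]
                refine add_le_add le_rfl (setLIntegral_mono' measurableSet_Ioc fun s hs => ?_)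
                refine mul_le_mul' (ENNReal.ofReal_le_ofReal ?_) le_rfl
                exact pow_le_pow_left₀ ht.1.le hs.1.le k
            _ ≤ _ := add_le_add le_rfl (lintegral_mono_set fun s hs => ht.1.trans hs.1)
      _ = _ := by simp
  calc _ = ∫⁻ x, H x ∂lam := (lintegral_indicator measurableSet_closedBall _).symm
    _ ≤ ∫⁻ y : sphere (0 : E) 1, (‖F y‖ₑ +
          ∫⁻ t in Ioi (0 : ℝ), ENNReal.ofReal (t ^ k) * G (t • (y : E))) ∂lam.toSphere := by
        rw [lintegral_eq_lintegral_toSphere lam hH]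
        exact lintegral_mono hray
    _ = _ := by
        rw [lintegral_add_left hFy, ← lintegral_eq_lintegral_toSphere lam hG,
          lintegral_indicator measurableSet_closedBall]

/-- Pointwise representation up to the boundary: average over `z` in the ball the fundamental theorem
of calculus on the segment from `y` to `z`. At time `t ∈ (0, 2]` the point `y + (t / 2) (z - y)` sweeps
a homothetic copy of the ball inside `closedBall y t`, whence a Riesz potential of the gradient. -/
theorem enorm_mul_measure_closedBall_le (hF : ContDiffOn ℝ m F (closedBall 0 1))
    (hm : 1 ≤ m) {y : E} (hy : y ∈ closedBall (0 : E) 1) :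
    ‖F y‖ₑ * lam (closedBall 0 1) ≤ ∫⁻ x in closedBall 0 1, ‖F x‖ₑ ∂lam +
      2 ^ Module.finrank ℝ E * rieszPotential (Module.finrank ℝ E) lam
        ((closedBall (0 : E) 1).indicator fun x => ‖gradientWithin F (closedBall 0 1) x‖ₑ) y := by
  set B := closedBall (0 : E) 1 with hB
  set G := B.indicator fun x => ‖gradientWithin F B x‖ₑ with hGdef
  have hG : Measurable G := measurable_indicator_enorm_gradientWithin hF hm
  have hFm : AEMeasurable (fun z => ‖F z‖ₑ) (lam.restrict B) :=
    (continuous_enorm.comp_continuousOn hF.continuousOn).aemeasurable measurableSet_closedBall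
  have hpt : ∀ z ∈ B, ‖F y‖ₑ ≤ ‖F z‖ₑ + ∫⁻ t in Ioc (0 : ℝ) 2, G (y + (t / 2) • (z - y)) := by
    intro z hz
    -- the parameter runs over `[0, 2]`, so that the speed `‖v‖` is at most one
    set v : E := (2⁻¹ : ℝ) • (z - y) with hv
    have hmem : ∀ t ∈ Icc (0 : ℝ) 2, y + t • v ∈ B := by
      intro t ht
      have := (convex_closedBall (0 : E) 1).add_smul_sub_mem hy hz (t := t / 2)
        ⟨by linarith [ht.1], by linarith [ht.2]⟩
      rwa [hv, smul_smul, ← div_eq_mul_inv]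
    have h1 := enorm_sub_le_lintegral_gradientWithin hF uniqueDiffOn_closedBall_one hm y v
      zero_le_two hmem
    have hv1 : ‖v‖ₑ ≤ 1 := by
      rw [← ofReal_norm, ENNReal.ofReal_le_one, hv, norm_smul]
      rw [hB, mem_closedBall_zero_iff] at hy hz
      have := norm_sub_le z y
      norm_num
      linarith
    have h2 : y + (2 : ℝ) • v = z := by rw [hv, smul_smul]; simp
    rw [h2, zero_smul, add_zero] at h1
    calc ‖F y‖ₑ = ‖F z - (F z - F y)‖ₑ := by rw [sub_sub_cancel]
      _ ≤ ‖F z‖ₑ + ‖F z - F y‖ₑ := enorm_sub_le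
      _ ≤ ‖F z‖ₑ + 1 * ∫⁻ t in Ioc (0 : ℝ) 2, ‖gradientWithin F B (y + t • v)‖ₑ := by
          gcongr
          exact h1.trans (by gcongr)
      _ = _ := by
          rw [one_mul]
          congr 1
          refine setLIntegral_congr_fun measurableSet_Ioc fun t ht => ?_
          have := hmem t (Ioc_subset_Icc_self ht)
          have e : y + (t / 2) • (z - y) = y + t • v := by rw [hv, smul_smul, ← div_eq_mul_inv]
          simp only [e, hGdef, indicator_of_mem this]
  have hscale : ∀ t ∈ Ioc (0 : ℝ) 2, ∫⁻ z in B, G (y + (t / 2) • (z - y)) ∂lam ≤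
      2 ^ Module.finrank ℝ E * (ENNReal.ofReal t ^ (-(Module.finrank ℝ E : ℝ)) *
        ∫⁻ x in closedBall y t, G x ∂lam) := by
    intro t ht
    calc _ ≤ ∫⁻ z in B, (closedBall y t).indicator G (y + (t / 2) • (z - y)) ∂lam := by
          refine setLIntegral_mono' measurableSet_closedBall fun z hz => ?_
          have : y + (t / 2) • (z - y) ∈ closedBall y t := by
            rw [mem_closedBall, dist_eq_norm, add_sub_cancel_left, norm_smul,
              Real.norm_of_nonneg (by linarith [ht.1])]
            rw [hB, mem_closedBall_zero_iff] at hy hz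
            have := norm_sub_le z y
            nlinarith [ht.1]
          rw [indicator_of_mem this]
      _ ≤ ∫⁻ z, (closedBall y t).indicator G (y + (t / 2) • (z - y)) ∂lam :=
          setLIntegral_le_lintegral _ _
      _ = _ := by
          rw [lintegral_comp_homothety lam y (by linarith [ht.1])
            (hG.indicator measurableSet_closedBall), lintegral_indicator measurableSet_closedBall,
            ← mul_assoc]
          congr 1
          rw [div_eq_inv_mul, ENNReal.ofReal_mul (by norm_num),
            ENNReal.mul_rpow_of_ne_top (by simp) (by simp)]
          congr 1
          rw [ENNReal.ofReal_inv_of_pos two_pos, ENNReal.inv_rpow, ENNReal.rpow_neg, inv_inv,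
            ENNReal.rpow_natCast]
          simp
  have hm2 : Measurable fun p : E × ℝ => G (y + (p.2 / 2) • (p.1 - y)) := by
    refine hG.comp (Continuous.measurable ?_)
    fun_prop
  calc _ = ∫⁻ z in B, ‖F y‖ₑ ∂lam := by rw [setLIntegral_const]
    _ ≤ ∫⁻ z in B, (‖F z‖ₑ + ∫⁻ t in Ioc (0 : ℝ) 2, G (y + (t / 2) • (z - y))) ∂lam :=
        setLIntegral_mono' measurableSet_closedBall hpt
    _ = ∫⁻ z in B, ‖F z‖ₑ ∂lam +
          ∫⁻ t in Ioc (0 : ℝ) 2, ∫⁻ z in B, G (y + (t / 2) • (z - y)) ∂lam := by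
        rw [lintegral_add_left' hFm, lintegral_lintegral_swap hm2.aemeasurable]
    _ ≤ ∫⁻ z in B, ‖F z‖ₑ ∂lam + ∫⁻ t in Ioc (0 : ℝ) 2, 2 ^ Module.finrank ℝ E *
          (ENNReal.ofReal t ^ (-(Module.finrank ℝ E : ℝ)) * ∫⁻ x in closedBall y t, G x ∂lam) :=
        add_le_add le_rfl (setLIntegral_mono' measurableSet_Ioc hscale)
    _ ≤ ∫⁻ z in B, ‖F z‖ₑ ∂lam + ∫⁻ t in Ioi (0 : ℝ), 2 ^ Module.finrank ℝ E *
          (ENNReal.ofReal t ^ (-(Module.finrank ℝ E : ℝ)) * ∫⁻ x in closedBall y t, G x ∂lam) :=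
        add_le_add le_rfl (lintegral_mono_set Ioc_subset_Ioi_self)
    _ = _ := by
        rw [rieszPotential_eq_lintegral_closedBall _ lam hG,
          lintegral_const_mul' _ _ (by finiteness)]

end Ball

/-! ### The trace inequality -/

theorem sq_add_le_two_mul (a b : ℝ≥0∞) : (a + b) ^ 2 ≤ 2 * (a ^ 2 + b ^ 2) := by
  have := ENNReal.rpow_add_le_mul_rpow_add_rpow a b (p := 2) (by norm_num)
  norm_num at this
  exact_mod_cast this

theorem sq_lintegral_le_measure_mul {α : Type*} [MeasurableSpace α] (μ : Measure α)
    {f : α → ℝ≥0∞} (hf : AEMeasurable f μ) :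
    (∫⁻ x, f x ∂μ) ^ 2 ≤ μ univ * ∫⁻ x, f x ^ 2 ∂μ := by
  have h := ENNReal.lintegral_mul_le_Lp_mul_Lq μ Real.HolderConjugate.two_two
    (f := f) (g := fun _ => 1) hf aemeasurable_const
  simp only [Pi.mul_apply, mul_one, ENNReal.one_rpow, lintegral_const, one_mul] at h
  calc _ ≤ ((∫⁻ x, f x ^ (2 : ℝ) ∂μ) ^ (1 / 2 : ℝ) * μ univ ^ (1 / 2 : ℝ)) ^ 2 := by gcongr
    _ = _ := by
      rw [mul_pow, ← ENNReal.rpow_natCast, ← ENNReal.rpow_natCast, ← ENNReal.rpow_mul,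
        ← ENNReal.rpow_mul]
      norm_num
      rw [mul_comm]

section Trace

variable {E : Type*} [NormedAddCommGroup E] [InnerProductSpace ℝ E] [FiniteDimensional ℝ E]
  [MeasurableSpace E] [BorelSpace E] (lam : Measure E) [lam.IsAddHaarMeasure]

/-- The trace inequality for nonnegative extended real weights, with lower integrals. -/
theorem exists_lintegral_mul_sq_le (hE : 3 ≤ Module.finrank ℝ E) {σ : ℝ} (hσ : 1 < σ) (C₂ : ℝ≥0) :
    ∃ K : ℝ≥0, ∀ V : sphere (0 : E) 1 → ℝ≥0∞, Measurable V →
      (∀ x r, 0 < r → ∫⁻ y in closedBall x r, V y ^ σ ∂lam.toSphere ≤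
        C₂ * ENNReal.ofReal r ^ ((Module.finrank ℝ E : ℝ) - 1 - σ)) →
      ∀ (F : E → ℝ) (m : ℕ∞ω), 1 ≤ m → ContDiffOn ℝ m F (closedBall 0 1) →
      ∫⁻ y : sphere (0 : E) 1, V y * ‖F y‖ₑ ^ 2 ∂lam.toSphere ≤
        K * ∫⁻ x in closedBall 0 1, ‖gradientWithin F (closedBall 0 1) x‖ₑ ^ 2 ∂lam +
        K * ∫⁻ y : sphere (0 : E) 1, ‖F y‖ₑ ^ 2 ∂lam.toSphere := by
  have hnt : Nontrivial E := Module.nontrivial_of_finrank_pos (R := ℝ) (by omega)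
  set n : ℝ := (Module.finrank ℝ E : ℝ) with hn
  have hn3 : (3 : ℝ) ≤ n := by rw [hn]; exact_mod_cast hE
  set B := closedBall (0 : E) 1 with hB
  set ν := lam.toSphere with hν
  -- constants of the growth conditions on the ball and on the sphere
  set w : ℝ≥0 := (lam (ball 0 1)).toNNReal with hw
  have hwc : (w : ℝ≥0∞) = lam (ball 0 1) := ENNReal.coe_toNNReal measure_ball_lt_top.ne
  have hw0 : w ≠ 0 := by
    have : lam (ball (0 : E) 1) ≠ 0 := (measure_ball_pos lam 0 one_pos).ne'
    rw [← hwc] at this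
    exact_mod_cast this
  have hlam : ∀ (x : E) (t : ℝ), 0 < t → lam (closedBall x t) ≤ w * ENNReal.ofReal t ^ n := by
    intro x t ht
    rw [Measure.addHaar_closedBall _ _ ht.le, ENNReal.ofReal_pow ht.le, hwc, hn,
      ENNReal.rpow_natCast, mul_comm]
  have hBw : lam B = w := by rw [hB, Measure.addHaar_unitClosedBall_eq_addHaar_unitBall, hwc]
  set C₁ : ℝ≥0 := 2 ^ Module.finrank ℝ E * w + (ν univ).toNNReal with hC₁
  have hνu : ν univ ≤ C₁ := by
    rw [hC₁, ENNReal.coe_add, ENNReal.coe_toNNReal (measure_ne_top _ _)]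
    exact le_add_self
  have hνb : ∀ (x : sphere (0 : E) 1) (r : ℝ), 0 < r →
      ν (closedBall x r) ≤ C₁ * ENNReal.ofReal r ^ (n - 1) := by
    intro x r hr
    refine (toSphere_closedBall_le lam x hr).trans ?_
    rw [← hwc, hC₁]
    gcongr
    push_cast
    exact le_self_add
  obtain ⟨Λ, hΛ0, hΛ⟩ := exists_lintegral_lintegral_rieszKernel_le (X := sphere (0 : E) 1)
    (d := n - 1) hσ (by linarith) C₁ C₂
  set P : ℝ≥0 := 2 ^ Module.finrank ℝ E with hP
  set M : ℝ≥0 := P * w * Λ with hM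
  set T : ℝ≥0 := C₁ + C₂ * 2 ^ (n - 1 - σ) with hT
  set K : ℝ≥0 := (w ^ 2)⁻¹ * (4 * T * (C₁ + w) + 2 * P ^ 2 * M) with hK
  refine ⟨K, fun V hV hVM F m hm hF => ?_⟩
  set μ := ν.withDensity V with hμ
  -- the total mass of the weight
  have hμT : μ univ ≤ T := by
    rcases isEmpty_or_nonempty (sphere (0 : E) 1) with h | ⟨⟨x₀⟩⟩
    · simp [eq_empty_of_isEmpty]
    have huniv : closedBall x₀ 2 = univ := by
      refine eq_univ_of_forall fun y => ?_
      rw [mem_closedBall, Subtype.dist_eq]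
      have h1 := dist_triangle (y : E) 0 x₀
      have h2 : dist (y : E) 0 = 1 := y.2
      have h3 : dist (x₀ : E) 0 = 1 := x₀.2
      rw [dist_comm 0] at h1
      linarith
    -- `V ≤ 1 + V ^ σ`
    calc μ univ = ∫⁻ y, V y ∂ν := by
          rw [hμ, withDensity_apply _ MeasurableSet.univ, Measure.restrict_univ]
      _ ≤ ∫⁻ y, (1 + V y ^ σ) ∂ν := by
          refine lintegral_mono fun y => ?_
          rcases le_total (V y) 1 with h | h
          · exact h.trans le_self_add
          · refine le_trans ?_ le_add_self
            nth_rw 1 [← ENNReal.rpow_one (V y)]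
            exact ENNReal.rpow_le_rpow_of_exponent_le h hσ.le
      _ = ν univ + ∫⁻ y in closedBall x₀ 2, V y ^ σ ∂ν := by
          rw [lintegral_add_left measurable_const, huniv, Measure.restrict_univ, lintegral_one]
      _ ≤ C₁ + C₂ * ENNReal.ofReal 2 ^ (n - 1 - σ) := add_le_add hνu (hVM x₀ 2 two_pos)
      _ = T := by
          rw [hT, ENNReal.coe_add C₁ (C₂ * 2 ^ (n - 1 - σ)), ENNReal.coe_mul C₂,
            ENNReal.coe_rpow_of_ne_zero two_ne_zero, ENNReal.ofReal_ofNat, ENNReal.coe_ofNat]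
  have hμfin : IsFiniteMeasure μ := ⟨hμT.trans_lt ENNReal.coe_lt_top⟩
  set G := B.indicator fun x => ‖gradientWithin F B x‖ₑ with hGdef
  have hG : Measurable G := measurable_indicator_enorm_gradientWithin hF hm
  have hGcont : ContinuousOn (gradientWithin F B) B :=
    hF.continuousOn_gradientWithin uniqueDiffOn_closedBall_one hm
  obtain ⟨b, hb⟩ := (isCompact_closedBall (0 : E) 1).exists_bound_of_continuousOn hGcont
  have hGb (x : E) : G x ≤ ENNReal.ofReal b := by
    by_cases hx : x ∈ B
    · rw [hGdef, indicator_of_mem hx, ← ofReal_norm]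
      exact ENNReal.ofReal_le_ofReal (hb x hx)
    · simp [hGdef, hx]
  have hG1 : ∫⁻ x, G x ∂lam = ∫⁻ x in B, ‖gradientWithin F B x‖ₑ ∂lam :=
    lintegral_indicator measurableSet_closedBall _
  have hG2 : ∫⁻ x, G x ^ 2 ∂lam = ∫⁻ x in B, ‖gradientWithin F B x‖ₑ ^ 2 ∂lam := by
    rw [← lintegral_indicator measurableSet_closedBall]
    refine lintegral_congr fun x => ?_
    by_cases hx : x ∈ B <;> simp [hGdef, hx, hB ▸ hx]
  have hGi : ∫⁻ x, G x ∂lam ≠ ⊤ := by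
    rw [hG1]
    refine ne_top_of_le_ne_top ?_ (setLIntegral_mono' measurableSet_closedBall
      (g := fun _ => ENNReal.ofReal b) fun x hx => ?_)
    · rw [setLIntegral_const, hBw]; finiteness
    · have := hGb x
      rwa [hGdef, indicator_of_mem hx] at this
  -- the potential estimate
  have hpot : ∫⁻ y : sphere (0 : E) 1, rieszPotential n lam G y ^ 2 ∂μ ≤
      M * ∫⁻ x, G x ^ 2 ∂lam := by
    have h1 := lintegral_sq_rieszPotential_comp_le (ι := ((↑) : sphere (0 : E) 1 → E))
      isometry_subtype_coe measurable_subtype_coe lam (n := n) (by linarith) hw0 hlam μ hΛ0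
      (hΛ ν hνu hνb V hV hVM) hG ENNReal.ofReal_ne_top hGb hGi
    refine h1.trans_eq ?_
    rw [hM, hP, hn, ENNReal.rpow_natCast]
    push_cast
    rfl
  -- the mean of `F` over the ball
  have hFS : Continuous fun y : sphere (0 : E) 1 => F y :=
    hF.continuousOn.comp_continuous continuous_subtype_val fun y => sphere_subset_closedBall y.2
  have hFSm : Measurable fun y : sphere (0 : E) 1 => ‖F y‖ₑ := hFS.enorm.measurable
  set a := ∫⁻ x in B, ‖F x‖ₑ ∂lam with ha
  set I₁ := ∫⁻ y : sphere (0 : E) 1, ‖F y‖ₑ ^ 2 ∂ν with hI₁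
  set I₂ := ∫⁻ x in B, ‖gradientWithin F B x‖ₑ ^ 2 ∂lam with hI₂
  have ha2 : a ^ 2 ≤ 2 * (C₁ * I₁ + w * I₂) := by
    have h1 : a ≤ (∫⁻ y : sphere (0 : E) 1, ‖F y‖ₑ ∂ν) + ∫⁻ x in B, ‖gradientWithin F B x‖ₑ ∂lam :=
      lintegral_enorm_closedBall_le lam hF hm
    calc a ^ 2 ≤ _ := pow_le_pow_left' h1 2
      _ ≤ _ := sq_add_le_two_mul _ _
      _ ≤ _ := by
          gcongr
          · exact (sq_lintegral_le_measure_mul ν hFSm.aemeasurable).trans (by gcongr)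
          · refine (sq_lintegral_le_measure_mul (lam.restrict B) ?_).trans_eq ?_
            · exact hGcont.enorm.aemeasurable measurableSet_closedBall
            · rw [Measure.restrict_apply_univ, hBw]
  have hpt (y : sphere (0 : E) 1) : ‖F y‖ₑ ^ 2 * (w : ℝ≥0∞) ^ 2 ≤
      2 * a ^ 2 + 2 * P ^ 2 * rieszPotential n lam G y ^ 2 := by
    have h1 := enorm_mul_measure_closedBall_le lam hF hm (sphere_subset_closedBall y.2)
    rw [← hB, hBw] at h1
    calc _ = (‖F y‖ₑ * w) ^ 2 := by ring
      _ ≤ _ := pow_le_pow_left' h1 2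
      _ ≤ _ := sq_add_le_two_mul _ _
      _ = _ := by rw [hP]; push_cast; ring
  have hpotm : Measurable fun y : sphere (0 : E) 1 => rieszPotential n lam G y ^ 2 :=
    ((measurable_rieszPotential n lam hG).comp measurable_subtype_coe).pow_const 2
  have hmain : (∫⁻ y : sphere (0 : E) 1, V y * ‖F y‖ₑ ^ 2 ∂ν) * (w : ℝ≥0∞) ^ 2 ≤
      (4 * T * (C₁ + w) + 2 * P ^ 2 * M) * (I₂ + I₁) := by
    calc _ = ∫⁻ y : sphere (0 : E) 1, ‖F y‖ₑ ^ 2 * (w : ℝ≥0∞) ^ 2 ∂μ := by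
          rw [hμ, lintegral_withDensity_eq_lintegral_mul _ hV (by fun_prop),
            ← lintegral_mul_const _ (by fun_prop)]
          refine lintegral_congr fun y => ?_
          rw [Pi.mul_apply, mul_assoc]
      _ ≤ ∫⁻ y : sphere (0 : E) 1, (2 * a ^ 2 + 2 * P ^ 2 * rieszPotential n lam G y ^ 2) ∂μ :=
          lintegral_mono hpt
      _ = 2 * a ^ 2 * μ univ +
            2 * P ^ 2 * ∫⁻ y : sphere (0 : E) 1, rieszPotential n lam G y ^ 2 ∂μ := by
          rw [lintegral_add_left measurable_const, lintegral_const, lintegral_const_mul _ hpotm]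
      _ ≤ 2 * (2 * (C₁ * I₁ + w * I₂)) * T + 2 * P ^ 2 * (M * I₂) := by
          rw [hG2] at hpot
          gcongr
      _ ≤ 2 * (2 * ((C₁ + w) * (I₂ + I₁))) * T + 2 * P ^ 2 * (M * (I₂ + I₁)) := by
          gcongr
          · rw [add_mul]
            gcongr
            · exact le_add_self
            · exact le_self_add
          · exact le_self_add
      _ = _ := by ring
  have hwE : (w : ℝ≥0∞) ^ 2 ≠ 0 := by
    have : (w : ℝ≥0∞) ≠ 0 := by exact_mod_cast hw0
    exact pow_ne_zero 2 this
  calc _ = (∫⁻ y : sphere (0 : E) 1, V y * ‖F y‖ₑ ^ 2 ∂ν) * (w : ℝ≥0∞) ^ 2 *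
        ((w : ℝ≥0∞) ^ 2)⁻¹ := by
        rw [mul_assoc, ENNReal.mul_inv_cancel hwE (by finiteness), mul_one]
    _ ≤ (4 * T * (C₁ + w) + 2 * P ^ 2 * M) * (I₂ + I₁) * ((w : ℝ≥0∞) ^ 2)⁻¹ := by gcongr
    _ = K * (I₂ + I₁) := by
        have hKE : (K : ℝ≥0∞) =
            ((w : ℝ≥0∞) ^ 2)⁻¹ * (4 * T * (C₁ + w) + 2 * P ^ 2 * M) := by
          rw [hK, ENNReal.coe_mul (w ^ 2)⁻¹, ENNReal.coe_inv (by positivity), ENNReal.coe_pow w]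
          congr 1
        rw [hKE]
        ring
    _ = _ := mul_add _ _ _

end Trace

/-- A Morrey bound on balls of radius at most `1`, with arbitrary centres, extends to all balls centred
on the sphere. Large radii are handled by a finite cover of the sphere by unit balls, and this is where
`σ < n - 1` is used. -/
theorem exists_forall_setLIntegral_closedBall_le {n : ℕ} {σ : ℝ} (hσ : σ < (n : ℝ) - 1) :
    ∃ C₂ : ℝ≥0, ∀ (ν : Measure (sphere (0 : EuclideanSpace ℝ (Fin n)) 1))
      (u : sphere (0 : EuclideanSpace ℝ (Fin n)) 1 → ℝ≥0∞),
      (∀ (p : EuclideanSpace ℝ (Fin n)) (r : ℝ), 0 < r → r ≤ 1 →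
        ∫⁻ y in {y : sphere (0 : EuclideanSpace ℝ (Fin n)) 1 |
          (y : EuclideanSpace ℝ (Fin n)) ∈ ball p r}, u y ∂ν ≤
            ENNReal.ofReal r ^ ((n : ℝ) - 1 - σ)) →
      ∀ x r, 0 < r → ∫⁻ y in closedBall x r, u y ∂ν ≤
        C₂ * ENNReal.ofReal r ^ ((n : ℝ) - 1 - σ) := by
  obtain ⟨t, -, htfin, htcov⟩ := finite_cover_balls_of_compact
    (isCompact_sphere (0 : EuclideanSpace ℝ (Fin n)) 1) one_pos
  lift t to Finset (EuclideanSpace ℝ (Fin n)) using htfin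
  have hδ : 0 ≤ (n : ℝ) - 1 - σ := by linarith
  refine ⟨(t.card + 1) * 2 ^ ((n : ℝ) - 1 - σ), fun ν u hu x r hr => ?_⟩
  have h2 : (((t.card + 1) * 2 ^ ((n : ℝ) - 1 - σ) : ℝ≥0) : ℝ≥0∞) *
      ENNReal.ofReal r ^ ((n : ℝ) - 1 - σ) =
      (t.card + 1) * ENNReal.ofReal (2 * r) ^ ((n : ℝ) - 1 - σ) := by
    rw [ENNReal.ofReal_mul zero_le_two, ENNReal.mul_rpow_of_nonneg _ _ hδ, ENNReal.coe_mul,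
      ENNReal.coe_rpow_of_ne_zero two_ne_zero]
    simp [mul_assoc]
  rw [h2]
  rcases le_or_gt (2 * r) 1 with hr1 | hr1
  · calc _ ≤ ∫⁻ y in {y : sphere (0 : EuclideanSpace ℝ (Fin n)) 1 |
          (y : EuclideanSpace ℝ (Fin n)) ∈ ball (x : EuclideanSpace ℝ (Fin n)) (2 * r)}, u y ∂ν := by
          refine lintegral_mono_set fun y hy => ?_
          have : dist (y : EuclideanSpace ℝ (Fin n)) x ≤ r := hy
          rw [mem_ofPred_eq, mem_ball]
          linarith
      _ ≤ 1 * ENNReal.ofReal (2 * r) ^ ((n : ℝ) - 1 - σ) := by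
          rw [one_mul]; exact hu x (2 * r) (by linarith) hr1
      _ ≤ _ := by gcongr; exact le_add_self
  · calc _ ≤ ∫⁻ y in ⋃ p : t, {y : sphere (0 : EuclideanSpace ℝ (Fin n)) 1 |
          (y : EuclideanSpace ℝ (Fin n)) ∈ ball (p : EuclideanSpace ℝ (Fin n)) 1}, u y ∂ν := by
          refine lintegral_mono_set fun y _ => ?_
          simpa using htcov y.2
      _ ≤ ∑' p : t, ∫⁻ y in {y : sphere (0 : EuclideanSpace ℝ (Fin n)) 1 |
          (y : EuclideanSpace ℝ (Fin n)) ∈ ball (p : EuclideanSpace ℝ (Fin n)) 1}, u y ∂ν :=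
          lintegral_iUnion_le _ _
      _ ≤ ∑ p : t, 1 := by
          rw [tsum_fintype]
          refine Finset.sum_le_sum fun p _ => ?_
          simpa using hu p 1 one_pos le_rfl
      _ ≤ (t.card + 1) * 1 := by simp
      _ ≤ _ := by
          gcongr
          exact ENNReal.one_le_rpow (ENNReal.one_le_ofReal.2 hr1.le) (by linarith)

theorem corollaryA2 (n : ℕ) (hn : 3 ≤ n) (σ : ℝ) (hσ₁ : 1 < σ) (hσ₂ : σ < (n : ℝ) - 1) :
    ∃ C : ℝ, 0 < C ∧
      ∀ V : sphere (0 : EuclideanSpace ℝ (Fin n)) 1 → ℝ,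
        Continuous V → (∀ y, 0 ≤ V y) →
        (∀ (p : EuclideanSpace ℝ (Fin n)) (r : ℝ), 0 < r → r ≤ 1 →
          (r ^ (σ + 1 - (n : ℝ)) *
            ∫ y in {y : sphere (0 : EuclideanSpace ℝ (Fin n)) 1 |
                (y : EuclideanSpace ℝ (Fin n)) ∈ ball p r},
              V y ^ σ ∂(volume : Measure (EuclideanSpace ℝ (Fin n))).toSphere) ^ (1 / σ) ≤ 1) →
        ∀ F : EuclideanSpace ℝ (Fin n) → ℝ,
          ContDiffOn ℝ ∞ F (closedBall 0 1) →
          ∫ y, V y * F (y : EuclideanSpace ℝ (Fin n)) ^ 2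
              ∂(volume : Measure (EuclideanSpace ℝ (Fin n))).toSphere ≤
            C * (∫ x in closedBall (0 : EuclideanSpace ℝ (Fin n)) 1,
                ‖gradientWithin F (closedBall 0 1) x‖ ^ 2) +
            C * ∫ y, F (y : EuclideanSpace ℝ (Fin n)) ^ 2
              ∂(volume : Measure (EuclideanSpace ℝ (Fin n))).toSphere := by
  have hfr : Module.finrank ℝ (EuclideanSpace ℝ (Fin n)) = n := finrank_euclideanSpace_fin
  obtain ⟨C₂, hC₂⟩ := exists_forall_setLIntegral_closedBall_le hσ₂
  obtain ⟨K, hK⟩ := exists_lintegral_mul_sq_le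
    (volume : Measure (EuclideanSpace ℝ (Fin n))) (by rw [hfr]; exact hn) hσ₁ C₂
  rw [hfr] at hK
  refine ⟨K + 1, by positivity, fun V hV hV0 hVM F hF => ?_⟩
  set ν := (volume : Measure (EuclideanSpace ℝ (Fin n))).toSphere with hν
  have hσ0 : 0 < σ := by linarith
  have hVσ : Continuous fun y => V y ^ σ := hV.rpow_const fun y => Or.inr hσ0.le
  have hVσi : Integrable (fun y => V y ^ σ) ν :=
    hVσ.integrable_of_hasCompactSupport (HasCompactSupport.of_compactSpace _)
  have hFS : Continuous fun y : sphere (0 : EuclideanSpace ℝ (Fin n)) 1 => F y :=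
    hF.continuousOn.comp_continuous continuous_subtype_val fun y => sphere_subset_closedBall y.2
  have hGc : ContinuousOn (gradientWithin F (closedBall 0 1)) (closedBall 0 1) :=
    hF.continuousOn_gradientWithin uniqueDiffOn_closedBall_one (by simp)
  have hMorrey : ∀ (p : EuclideanSpace ℝ (Fin n)) (r : ℝ), 0 < r → r ≤ 1 →
      ∫⁻ y in {y : sphere (0 : EuclideanSpace ℝ (Fin n)) 1 |
        (y : EuclideanSpace ℝ (Fin n)) ∈ ball p r}, ENNReal.ofReal (V y) ^ σ ∂ν ≤
          ENNReal.ofReal r ^ ((n : ℝ) - 1 - σ) := by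
    intro p r hr hr1
    set A := {y : sphere (0 : EuclideanSpace ℝ (Fin n)) 1 |
        (y : EuclideanSpace ℝ (Fin n)) ∈ ball p r} with hA
    have hI0 : 0 ≤ ∫ y in A, V y ^ σ ∂ν :=
      integral_nonneg fun y => Real.rpow_nonneg (hV0 y) σ
    have h1 : r ^ (σ + 1 - (n : ℝ)) * ∫ y in A, V y ^ σ ∂ν ≤ 1 := by
      by_contra! hlt
      exact absurd (hVM p r hr hr1) (not_le.2 (Real.one_lt_rpow hlt (by positivity)))
    have h2 : ∫ y in A, V y ^ σ ∂ν ≤ r ^ ((n : ℝ) - 1 - σ) := by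
      calc _ = r ^ ((n : ℝ) - 1 - σ) * (r ^ (σ + 1 - (n : ℝ)) * ∫ y in A, V y ^ σ ∂ν) := by
            rw [← mul_assoc, ← Real.rpow_add hr,
              show (n : ℝ) - 1 - σ + (σ + 1 - (n : ℝ)) = 0 by ring, Real.rpow_zero, one_mul]
        _ ≤ r ^ ((n : ℝ) - 1 - σ) * 1 := by gcongr
        _ = _ := mul_one _
    calc _ = ∫⁻ y in A, ENNReal.ofReal (V y ^ σ) ∂ν :=
          lintegral_congr fun y => ENNReal.ofReal_rpow_of_nonneg (hV0 y) hσ0.le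
      _ = ENNReal.ofReal (∫ y in A, V y ^ σ ∂ν) :=
          (ofReal_integral_eq_lintegral_ofReal hVσi.integrableOn
            (Filter.Eventually.of_forall fun y => Real.rpow_nonneg (hV0 y) σ)).symm
      _ ≤ ENNReal.ofReal (r ^ ((n : ℝ) - 1 - σ)) := ENNReal.ofReal_le_ofReal h2
      _ = _ := (ENNReal.ofReal_rpow_of_pos hr).symm
  have hmain := hK (fun y => ENNReal.ofReal (V y)) hV.measurable.ennreal_ofReal
    (hC₂ ν _ hMorrey) F ∞ (by simp) hF
  have hsq (z : ℝ) : ‖z‖ₑ ^ 2 = ENNReal.ofReal (z ^ 2) := by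
    rw [← ofReal_norm, ← ENNReal.ofReal_pow (norm_nonneg z), Real.norm_eq_abs, sq_abs]
  have hsq' (z : EuclideanSpace ℝ (Fin n)) : ‖z‖ₑ ^ 2 = ENNReal.ofReal (‖z‖ ^ 2) := by
    rw [← ofReal_norm, ← ENNReal.ofReal_pow (norm_nonneg z)]
  simp only [hsq, hsq', ← ENNReal.ofReal_mul (hV0 _)] at hmain
  have hVFi : Integrable (fun y : sphere (0 : EuclideanSpace ℝ (Fin n)) 1 => V y * F y ^ 2) ν :=
    (hV.mul (hFS.pow 2)).integrable_of_hasCompactSupport (HasCompactSupport.of_compactSpace _)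
  have hFi : Integrable (fun y : sphere (0 : EuclideanSpace ℝ (Fin n)) 1 => F y ^ 2) ν :=
    (hFS.pow 2).integrable_of_hasCompactSupport (HasCompactSupport.of_compactSpace _)
  have hGi : IntegrableOn (fun x => ‖gradientWithin F (closedBall 0 1) x‖ ^ 2)
      (closedBall (0 : EuclideanSpace ℝ (Fin n)) 1) :=
    (hGc.norm.pow 2).integrableOn_compact (isCompact_closedBall _ _)
  set I₀ := ∫ y, V y * F (y : EuclideanSpace ℝ (Fin n)) ^ 2 ∂ν
  set I₁ := ∫ y, F (y : EuclideanSpace ℝ (Fin n)) ^ 2 ∂ν with hI₁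
  set I₂ := ∫ x in closedBall (0 : EuclideanSpace ℝ (Fin n)) 1,
    ‖gradientWithin F (closedBall 0 1) x‖ ^ 2 with hI₂
  have hI₁0 : 0 ≤ I₁ := integral_nonneg fun y => sq_nonneg _
  have hI₂0 : 0 ≤ I₂ := integral_nonneg fun y => sq_nonneg _
  rw [← ofReal_integral_eq_lintegral_ofReal hVFi
      (Filter.Eventually.of_forall fun y => mul_nonneg (hV0 y) (sq_nonneg _)),
    ← ofReal_integral_eq_lintegral_ofReal hFi (Filter.Eventually.of_forall fun y => sq_nonneg _),
    ← ofReal_integral_eq_lintegral_ofReal hGi (Filter.Eventually.of_forall fun y => sq_nonneg _),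
    ← hI₁, ← hI₂, ← ENNReal.ofReal_coe_nnreal, ← ENNReal.ofReal_mul K.coe_nonneg, ← ENNReal.ofReal_mul K.coe_nonneg,
    ← ENNReal.ofReal_add (by positivity) (by positivity),
    ENNReal.ofReal_le_ofReal_iff (by positivity)] at hmain
  linarith
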